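/- Let $C=\begin{bmatrix}C_{11}&C_{12}\\C_{21}&C_{22}\end{bmatrix}$ be a square complex matrix partitioned with square diagonal blocks, and let $W'(C)=\{x^*Cx: x\neq 0\}$ be its angular numerical range. The field angle $\delta(C)$ is the angle subtended by the convex cone $W'(C)$ if this cone contains no line through the origin ($0$ if $C=0$), $\pi$ if it contains exactly one such line, and $2\pi$ if it is all of $\mathbb{C}$; $C$ is called semi-sectorial if $\delta(C)\le\pi$. A semi-sectorial matrix $C$ of rank $r$ has a decomposition $C=T^*\,\mathrm{diag}(0,D,E)\,T$ with $T$ nonsingular, $D=\mathrm{diag}(e^{i\theta_1},\dots,e^{i\theta_m})$, $\theta_0-\pi/2\le\theta_k\le\theta_0+\pi/2$ for all $k$, and $E$ a (possibly empty) direct sum of $(r-m)/2$ copies of $e^{i\theta_0}\begin{bmatrix}1&2\\0&1\end{bmatrix}$. Its phases $\phi_1(C)\ge\dots\ge\phi_r(C)$ are $\theta_1,\dots,\theta_m$ together with $(r-m)/2$ copies of each of $\theta_0+\pi/2$ and $\theta_0-\pi/2$. They are real numbers determined only up to the selection of $\theta_0$ (that is, up to a common shift by a multiple of $2\pi$ and,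 when $W'(C)$ is a line through the origin, up to replacing $\theta_0$ by $\theta_0+\pi$). Suppose that $C$ is semi-sectorial, $\mathcal{R}(C_{12})\subset\mathcal{R}(C_{11})$ and $\mathcal{R}(C_{21}^*)\subset\mathcal{R}(C_{11}^*)$, where $\mathcal{R}$ denotes the range. Let $C/_{11}=C_{22}-C_{21}C_{11}^{\dagger}C_{12}$ be the generalized Schur complement, where $\dagger$ is the Moore-Penrose inverse, and put $r=\mathrm{rank}(C)$, $\hat r=\mathrm{rank}(C/_{11})$. Then $C/_{11}$ is semi-sectorial, $C$ has phases, and $\hat r\le r$. Moreover, for every selection of the phases of $C$, if $\hat r\ge 1$, the phases of $C/_{11}$ can be selected in $[\phi_r(C),\phi_1(C)]$, and for every such selection $$\phi_j(C)\ \ge\ \phi_j(C/_{11})\ \ge\ \phi_{r-\hat r+j}(C),\qquad j=1,\dots,\hat r .$$ -/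

import Mathlib

open scoped Matrix

noncomputable section

namespace MatrixPhase

/-- The angular numerical range (angular field of values) of a square complex matrix:
`{ x* C x : x ≠ 0 }`. -/
def angularRange {ι : Type*} [Fintype ι] (C : Matrix ι ι ℂ) : Set ℂ :=
  {z | ∃ x : ι → ℂ, x ≠ 0 ∧ z = star x ⬝ᵥ (C *ᵥ x)}

/-- The set of (unoriented, in `[0, π]`) angles between two nonzero elements of a set of complex
numbers. For a salient convex cone, its supremum is the angle subtended by the cone; it is `0` for
the empty cone and for the cone `{0}`. -/
def anglesWithin (K : Set ℂ) : Set ℝ :=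
  {a | ∃ z ∈ K, ∃ w ∈ K, z ≠ 0 ∧ w ≠ 0 ∧ a = InnerProductGeometry.angle z w}

open Classical in
/-- The field angle `δ(C)`: `2π` if the angular numerical range is the whole plane, `π` if it
contains a line through the origin without being the whole plane, and the angle that it subtends
if it is salient. -/
def fieldAngle {ι : Type*} [Fintype ι] (C : Matrix ι ι ℂ) : ℝ :=
  if angularRange C = Set.univ then 2 * Real.pi
  else if ∃ u : ℂ, u ≠ 0 ∧ ∀ t : ℝ, (t : ℂ) * u ∈ angularRange C then Real.pi
  else sSup (anglesWithin (angularRange C))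

/-- A square complex matrix is semi-sectorial if its field angle is at most `π`. -/
def IsSemiSectorial {ι : Type*} [Fintype ι] (C : Matrix ι ι ℂ) : Prop :=
  fieldAngle C ≤ Real.pi

/-- The canonical matrix `diag(0_z, D, E)` of a generalized sectorial decomposition, where
`D = diag(e^{iθ_1}, …, e^{iθ_m})` and `E` consists of `p` diagonal blocks
`e^{iθ₀} [1 2; 0 1]`. -/
def sectorialForm {z m p : ℕ} (θ₀ : ℝ) (θ : Fin m → ℝ) :
    Matrix (Fin z ⊕ (Fin m ⊕ (Fin 2 × Fin p))) (Fin z ⊕ (Fin m ⊕ (Fin 2 × Fin p))) ℂ :=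
  Matrix.fromBlocks 0 0 0
    (Matrix.fromBlocks
      (Matrix.diagonal fun i => Complex.exp ((θ i : ℂ) * Complex.I)) 0 0
      (Matrix.blockDiagonal fun _ : Fin p =>
        Complex.exp ((θ₀ : ℂ) * Complex.I) • !![(1 : ℂ), 2; 0, 1]))

/-- `IsPhases C φ`: the sequence `φ 0 ≥ φ 1 ≥ ⋯ ≥ φ (r - 1)`, `r = rank C`, is a selection of the
phases of `C`. That is, `C` is congruent to a canonical matrix `diag(0, D, E)` as in
`sectorialForm`, with all the angles of `D` in `[θ₀ - π/2, θ₀ + π/2]`, and `φ` lists, in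
nonincreasing order, these angles and, for every block of `E`, the two angles `θ₀ ± π/2`.

Sectorial, quasi-sectorial and rotated Hermitian matrices are the special cases in which `E` is
empty. The angles are real numbers, and `θ₀` may be replaced by `θ₀ + 2π` (for rotated Hermitian
matrices by `θ₀ + π`), so that the phases are determined only up to this choice. -/
def IsPhases {ι : Type*} [Fintype ι] [DecidableEq ι] (C : Matrix ι ι ℂ) (φ : Fin C.rank → ℝ) :
    Prop :=
  Antitone φ ∧
  ∃ (z m p : ℕ) (e : ι ≃ Fin z ⊕ (Fin m ⊕ (Fin 2 × Fin p))) (θ₀ : ℝ) (θ : Fin m → ℝ)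
    (T : Matrix ι ι ℂ),
    IsUnit T ∧
    C = Tᴴ * (sectorialForm θ₀ θ).submatrix e e * T ∧
    (∀ i, θ₀ - Real.pi / 2 ≤ θ i ∧ θ i ≤ θ₀ + Real.pi / 2) ∧
    Multiset.map φ Finset.univ.val =
      Multiset.map θ Finset.univ.val + Multiset.replicate p (θ₀ + Real.pi / 2) +
        Multiset.replicate p (θ₀ - Real.pi / 2)

/-- The four Penrose equations: `X` is the Moore-Penrose generalized inverse of `A`. -/
structure IsMoorePenrose {m n : Type*} [Fintype m] [Fintype n]
    (A : Matrix m n ℂ) (X : Matrix n m ℂ) : Prop where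
  mul_mul_left : A * X * A = A
  mul_mul_right : X * A * X = X
  isHermitian_left : (A * X).IsHermitian
  isHermitian_right : (X * A).IsHermitian

theorem IsMoorePenrose.unique {m n : Type*} [Fintype m] [Fintype n]
    {A : Matrix m n ℂ} {X Y : Matrix n m ℂ} (hX : IsMoorePenrose A X) (hY : IsMoorePenrose A Y) :
    X = Y := by
  have hX3 : (A * X)ᴴ = A * X := hX.isHermitian_left
  have hY3 : (A * Y)ᴴ = A * Y := hY.isHermitian_left
  have hX4 : (X * A)ᴴ = X * A := hX.isHermitian_right
  have hY4 : (Y * A)ᴴ = Y * A := hY.isHermitian_right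
  have h1 : A * X = A * Y := by
    calc A * X = (A * X)ᴴ := hX3.symm
      _ = ((A * Y) * (A * X))ᴴ := by rw [← Matrix.mul_assoc, hY.mul_mul_left]
      _ = (A * X) * (A * Y) := by rw [Matrix.conjTranspose_mul, hX3, hY3]
      _ = A * Y := by rw [← Matrix.mul_assoc, hX.mul_mul_left]
  have h2 : X * A = Y * A := by
    calc X * A = (X * A)ᴴ := hX4.symm
      _ = ((X * A) * (Y * A))ᴴ := by
        rw [Matrix.mul_assoc X A, ← Matrix.mul_assoc A, hY.mul_mul_left]
      _ = (Y * A) * (X * A) := by rw [Matrix.conjTranspose_mul, hX4, hY4]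
      _ = Y * A := by rw [Matrix.mul_assoc Y A, ← Matrix.mul_assoc A, hX.mul_mul_left]
  calc X = X * A * X := hX.mul_mul_right.symm
    _ = Y * (A * X) := by rw [h2, Matrix.mul_assoc]
    _ = Y * A * Y := by rw [h1, Matrix.mul_assoc]
    _ = Y := hY.mul_mul_right

theorem exists_isMoorePenrose_of_isHermitian {n : Type*} [Fintype n]
    {H : Matrix n n ℂ} (hH : H.IsHermitian) :
    ∃ G : Matrix n n ℂ, G.IsHermitian ∧ G * H = H * G ∧ H * G * H = H ∧ G * H * G = G := by
  classical
  obtain ⟨U, d, hU, hd⟩ : ∃ (U : Matrix n n ℂ) (d : n → ℝ), Uᴴ * U = 1 ∧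
      H = U * Matrix.diagonal (fun i => (d i : ℂ)) * Uᴴ := by
    refine ⟨hH.eigenvectorUnitary, hH.eigenvalues, ?_, ?_⟩
    · exact Unitary.coe_star_mul_self hH.eigenvectorUnitary
    · exact hH.spectral_theorem
  have key : ∀ a b : n → ℂ, (U * Matrix.diagonal a * Uᴴ) * (U * Matrix.diagonal b * Uᴴ) =
      U * Matrix.diagonal (fun i => a i * b i) * Uᴴ := by
    intro a b
    calc _ = U * Matrix.diagonal a * (Uᴴ * U) * Matrix.diagonal b * Uᴴ := by
          simp only [Matrix.mul_assoc]
      _ = _ := by rw [hU, Matrix.mul_one, Matrix.mul_assoc U, Matrix.diagonal_mul_diagonal]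
  refine ⟨U * Matrix.diagonal (fun i => ((d i)⁻¹ : ℂ)) * Uᴴ, ?_, ?_, ?_, ?_⟩
  · have : (Matrix.diagonal (fun i => ((d i)⁻¹ : ℂ)))ᴴ =
        Matrix.diagonal (fun i => ((d i)⁻¹ : ℂ)) := by
      rw [Matrix.diagonal_conjTranspose]
      congr 1
      ext i
      simp
    rw [Matrix.IsHermitian, Matrix.conjTranspose_mul, Matrix.conjTranspose_mul, this,
      Matrix.conjTranspose_conjTranspose, Matrix.mul_assoc]
  · rw [hd, key, key]
    simp only [mul_comm]
  · rw [hd, key, key]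
    congr 3
    ext i
    exact mul_inv_mul_cancel (d i : ℂ)
  · rw [hd, key, key]
    congr 3
    ext i
    by_cases h : (d i : ℂ) = 0 <;> simp [h]

open scoped ComplexOrder in
theorem exists_isMoorePenrose {m n : Type*} [Fintype m] [Fintype n] (A : Matrix m n ℂ) :
    ∃ X : Matrix n m ℂ, IsMoorePenrose A X := by
  obtain ⟨G, hG, hcomm, hHGH, hGHG⟩ :=
    exists_isMoorePenrose_of_isHermitian (Matrix.isHermitian_conjTranspose_mul_self A)
  have hGt : Gᴴ = G := hG
  refine ⟨G * Aᴴ, ?_, ?_, ?_, ?_⟩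
  · have h1 : (A * G * (Aᴴ * A) - A)ᴴ = (Aᴴ * A) * G * Aᴴ - Aᴴ := by
      rw [Matrix.conjTranspose_sub, Matrix.conjTranspose_mul, Matrix.conjTranspose_mul,
        Matrix.conjTranspose_mul, Matrix.conjTranspose_conjTranspose, hGt]
      simp only [Matrix.mul_assoc]
    have h2 : ((Aᴴ * A) * G * Aᴴ - Aᴴ) * (A * G * (Aᴴ * A) - A) =
        ((Aᴴ * A) * G * (Aᴴ * A)) * G * (Aᴴ * A) - (Aᴴ * A) * G * (Aᴴ * A)
          - ((Aᴴ * A) * G * (Aᴴ * A) - Aᴴ * A) := by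
      simp only [Matrix.sub_mul, Matrix.mul_sub, Matrix.mul_assoc]
    have h0 : (A * G * (Aᴴ * A) - A)ᴴ * (A * G * (Aᴴ * A) - A) = 0 := by
      rw [h1, h2, hHGH, hHGH, sub_self]
    have h3 := sub_eq_zero.mp (Matrix.conjTranspose_mul_self_eq_zero.mp h0)
    simpa only [Matrix.mul_assoc] using h3
  · calc G * Aᴴ * A * (G * Aᴴ) = G * (Aᴴ * A) * G * Aᴴ := by simp only [Matrix.mul_assoc]
      _ = G * Aᴴ := by rw [hGHG]
  · simp only [Matrix.IsHermitian, Matrix.conjTranspose_mul,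
      Matrix.conjTranspose_conjTranspose, hGt, Matrix.mul_assoc]
  · rw [Matrix.IsHermitian, Matrix.mul_assoc, Matrix.conjTranspose_mul, hGt,
      (Matrix.isHermitian_conjTranspose_mul_self A).eq, hcomm]

/-- The Moore-Penrose generalized inverse of a complex matrix. -/
def pinv {m n : Type*} [Fintype m] [Fintype n] (A : Matrix m n ℂ) : Matrix n m ℂ :=
  (exists_isMoorePenrose A).choose

theorem isMoorePenrose_pinv {m n : Type*} [Fintype m] [Fintype n] (A : Matrix m n ℂ) :
    IsMoorePenrose A (pinv A) :=
  (exists_isMoorePenrose A).choose_spec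

/-- The generalized Schur complement `C₂₂ - C₂₁ C₁₁† C₁₂` of `C₁₁` in
`[C₁₁ C₁₂; C₂₁ C₂₂]`. -/
def schurComplement {m n : Type*} [Fintype m] [Fintype n]
    (C₁₁ : Matrix m m ℂ) (C₁₂ : Matrix m n ℂ) (C₂₁ : Matrix n m ℂ) (C₂₂ : Matrix n n ℂ) :
    Matrix n n ℂ :=
  C₂₂ - C₂₁ * pinv C₁₁ * C₁₂

end MatrixPhase

end

namespace MatrixPhase

open Module Complex ComplexConjugate

/-! Put `X = [-C₁₁†C₁₂; 1]`. The inclusion of ranges gives `C X = [0; S]`, hence `S = X* C X`: the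
Schur complement is a compression of `C` by an injective matrix
(`schurComplement_eq_conjTranspose_mul_mul`). So the angular range of `S` lies in that of `C`, and
the rank does not grow.

Phases exist because the angular range is a convex cone (`convex_angularRange`): unless it is the
whole plane, it lies in a closed half-plane centred at some direction `θ₀`
(`IsSemiSectorial.exists_halfPlane`). Rotated by `-θ₀`, the form is `H + iK` with `H`, `K` Hermitian
and `H ≥ 0`, and `hasCanonicalBasis_of_nonneg` splits canonical pieces off it by induction on the
dimension.

Interlacing is an inertia argument for the Hermitian forms `Im(e^{-iα} x* C x)`, with `α` strictly
inside the half-circle about `θ₀`. The number of phases above `α` is both the dimension of a space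
where this form is positive and the codimension of a space where it is nonpositive
(`IsPhasesAt.exists_definite`, `IsPhasesAt.exists_semidefinite`). Comparing the first space for `S`
with the second for `C` shows that `S` has at most as many phases above `α` as `C`
(`IsPhasesAt.card_le`), and likewise below. An `α` between two misordered phases would contradict
one of these counts. The comparison needs a common centre, which `IsPhases.isPhasesAt` supplies. -/

open Classical in
/-- The entries of the canonical matrix `diag(0, D, E)` with centre `0`, over arbitrary index types. -/
noncomputable def canonicalEntry {Z M P : Type*} (θ : M → ℝ) :
    Z ⊕ (M ⊕ (Fin 2 × P)) → Z ⊕ (M ⊕ (Fin 2 × P)) → ℂ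
  | Sum.inr (Sum.inl i), Sum.inr (Sum.inl j) => if i = j then exp (θ i * I) else 0
  | Sum.inr (Sum.inr (a, k)), Sum.inr (Sum.inr (b, l)) =>
      if k = l then (!![1, 2; 0, 1] : Matrix (Fin 2) (Fin 2) ℂ) a b else 0
  | _, _ => 0

/-- The sesquilinear form `B` has a basis with Gram matrix `diag(0, D, E)`, centred at `0`. -/
def HasCanonicalBasis {V : Type*} [AddCommGroup V] [Module ℂ V] (B : V →ₗ⋆[ℂ] V →ₗ[ℂ] ℂ) : Prop :=
  ∃ (Z M P : Type) (_ : Fintype Z) (_ : Fintype M) (_ : Fintype P) (θ : M → ℝ)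
    (b : Basis (Z ⊕ (M ⊕ (Fin 2 × P))) ℂ V),
    (∀ i, |θ i| ≤ Real.pi / 2) ∧ ∀ i j, B (b i) (b j) = canonicalEntry θ i j

/-! ### Splitting canonical pieces off a sesquilinear form. -/

section Splitting

variable {V : Type*} [AddCommGroup V] [Module ℂ V]

/-- A canonical system splitting off orthogonally on both sides from a form with a canonical basis
yields a canonical basis. -/
theorem HasCanonicalBasis.of_isCompl {B : V →ₗ⋆[ℂ] V →ₗ[ℂ] ℂ} {Z M P : Type}
    [Fintype Z] [Fintype M] [Fintype P] {θ : M → ℝ} (hθ : ∀ i, |θ i| ≤ Real.pi / 2)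
    {f : Z ⊕ (M ⊕ (Fin 2 × P)) → V} (hf : LinearIndependent ℂ f)
    (hB : ∀ i j, B (f i) (f j) = canonicalEntry θ i j)
    {U : Submodule ℂ V} (hU : IsCompl (Submodule.span ℂ (Set.range f)) U)
    (hl : ∀ i, ∀ u ∈ U, B (f i) u = 0) (hr : ∀ i, ∀ u ∈ U, B u (f i) = 0)
    (h : HasCanonicalBasis (B.domRestrict₁₂ U U)) : HasCanonicalBasis B := by
  obtain ⟨Z', M', P', _, _, _, θ', b, hθ', hb⟩ := h
  -- Canonical shapes are closed under direct sums: the indices of each of the three kinds are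
  -- merged.
  let e : (Z ⊕ (M ⊕ (Fin 2 × P))) ⊕ (Z' ⊕ (M' ⊕ (Fin 2 × P'))) ≃
      (Z ⊕ Z') ⊕ ((M ⊕ M') ⊕ (Fin 2 × (P ⊕ P'))) :=
    { toFun := fun x => match x with
        | .inl (.inl z) => .inl (.inl z)
        | .inl (.inr (.inl i)) => .inr (.inl (.inl i))
        | .inl (.inr (.inr (a, k))) => .inr (.inr (a, .inl k))
        | .inr (.inl z) => .inl (.inr z)
        | .inr (.inr (.inl i)) => .inr (.inl (.inr i))
        | .inr (.inr (.inr (a, k))) => .inr (.inr (a, .inr k))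
      invFun := fun x => match x with
        | .inl (.inl z) => .inl (.inl z)
        | .inr (.inl (.inl i)) => .inl (.inr (.inl i))
        | .inr (.inr (a, .inl k)) => .inl (.inr (.inr (a, k)))
        | .inl (.inr z) => .inr (.inl z)
        | .inr (.inl (.inr i)) => .inr (.inr (.inl i))
        | .inr (.inr (a, .inr k)) => .inr (.inr (.inr (a, k)))
      left_inv := by rintro ((z | i | ⟨a, k⟩) | (z | i | ⟨a, k⟩)) <;> rfl
      right_inv := by rintro ((z | z) | (i | i) | ⟨a, k | k⟩) <;> rfl }
  let c := (((Basis.span hf).prod b).map (Submodule.prodEquivOfIsCompl _ U hU)).reindex e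
  have hcl : ∀ i, c (e (.inl i)) = f i := fun i => by
    simp [c, Basis.prod_apply, Basis.span_apply]
  have hcr : ∀ i, c (e (.inr i)) = b i := fun i => by
    simp [c, Basis.prod_apply]
  refine ⟨Z ⊕ Z', M ⊕ M', P ⊕ P', inferInstance, inferInstance, inferInstance,
    Sum.elim θ θ', c, ?_, ?_⟩
  · rintro (i | i)
    · exact hθ i
    · exact hθ' i
  · intro i j
    obtain ⟨i, rfl⟩ := e.surjective i
    obtain ⟨j, rfl⟩ := e.surjective j
    rcases i with i | i <;> rcases j with j | j
    · rw [hcl, hcl, hB]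
      rcases i with z | i | ⟨a, k⟩ <;> rcases j with z' | j | ⟨a', k'⟩ <;>
        simp only [e, canonicalEntry, Equiv.coe_fn_mk, Sum.elim_inl] <;>
        (congr 1; rw [Sum.inl.injEq])
    · rw [hcl, hcr, hl _ _ (b j).2]
      rcases i with z | i | ⟨a, k⟩ <;> rcases j with z' | j | ⟨a', k'⟩ <;>
        simp [e, canonicalEntry]
    · rw [hcl, hcr, hr _ _ (b i).2]
      rcases i with z | i | ⟨a, k⟩ <;> rcases j with z' | j | ⟨a', k'⟩ <;>
        simp [e, canonicalEntry]
    · rw [hcr, hcr, ← LinearMap.domRestrict₁₂_apply, hb]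
      rcases i with z | i | ⟨a, k⟩ <;> rcases j with z' | j | ⟨a', k'⟩ <;>
        simp only [e, canonicalEntry, Equiv.coe_fn_mk, Sum.elim_inr] <;>
        (congr 1; rw [Sum.inr.injEq])

/-- The right orthogonal complement of a family of vectors. -/
def rightPerp {κ : Type*} (B : V →ₗ⋆[ℂ] V →ₗ[ℂ] ℂ) (f : κ → V) : Submodule ℂ V :=
  ⨅ i, LinearMap.ker (B (f i))

theorem mem_rightPerp {κ : Type*} {B : V →ₗ⋆[ℂ] V →ₗ[ℂ] ℂ} {f : κ → V} {x : V} :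
    x ∈ rightPerp B f ↔ ∀ i, B (f i) x = 0 := by
  simp [rightPerp]

/-- The hypothesis says that the Gram matrix is injective. It is square, hence also surjective, so
the values `B (f i) x` of any `x` are matched by a combination of the `f j`; the difference is the
component of `x` in the complement. -/
theorem isCompl_rightPerp {κ : Type*} [Fintype κ] {B : V →ₗ⋆[ℂ] V →ₗ[ℂ] ℂ} {f : κ → V}
    (h : ∀ c : κ → ℂ, (∀ i, ∑ j, c j * B (f i) (f j) = 0) → c = 0) :
    LinearIndependent ℂ f ∧ IsCompl (Submodule.span ℂ (Set.range f)) (rightPerp B f) := by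
  have hsum : ∀ (c : κ → ℂ) i, B (f i) (∑ j, c j • f j) = ∑ j, c j * B (f i) (f j) := by
    intro c i
    simp
  refine ⟨?_, ?_⟩
  · rw [Fintype.linearIndependent_iff]
    intro c hc
    have : c = 0 := h c fun i => by rw [← hsum, hc, map_zero]
    exact fun i => congrFun this i
  · let G : (κ → ℂ) →ₗ[ℂ] (κ → ℂ) :=
      LinearMap.pi fun i => (B (f i)).comp (Fintype.linearCombination ℂ f)
    have hG : ∀ c i, G c i = ∑ j, c j * B (f i) (f j) := by
      intro c i
      simp [G, Fintype.linearCombination_apply]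
    have hinj : Function.Injective G := by
      rw [← LinearMap.ker_eq_bot, LinearMap.ker_eq_bot']
      intro c hc
      exact h c fun i => by rw [← hG, hc, Pi.zero_apply]
    have hsurj := LinearMap.injective_iff_surjective.mp hinj
    constructor
    · rw [Submodule.disjoint_def]
      intro x hx hx'
      obtain ⟨c, rfl⟩ := (Submodule.mem_span_range_iff_exists_fun ℂ).mp hx
      rw [h c fun i => by rw [← hsum]; exact mem_rightPerp.mp hx' i]
      simp
    · rw [codisjoint_iff, eq_top_iff]
      intro x _
      obtain ⟨c, hc⟩ := hsurj fun i => B (f i) x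
      refine Submodule.mem_sup.mpr ⟨∑ j, c j • f j,
        (Submodule.mem_span_range_iff_exists_fun ℂ).mpr ⟨c, rfl⟩, x - ∑ j, c j • f j, ?_, by abel⟩
      rw [mem_rightPerp]
      intro i
      rw [map_sub, hsum, ← hG, hc, sub_self]

/-- Splitting off a non-isotropic vector. -/
theorem HasCanonicalBasis.of_vector {B : V →ₗ⋆[ℂ] V →ₗ[ℂ] ℂ} {v : V} (hv : B v v ≠ 0)
    (hre : 0 ≤ (B v v).re) (hperp : ∀ x, B v x = 0 → B x v = 0)
    (h : ∀ U : Submodule ℂ V, v ∉ U → HasCanonicalBasis (B.domRestrict₁₂ U U)) :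
    HasCanonicalBasis B := by
  have hn : 0 < ‖B v v‖ := norm_pos_iff.mpr hv
  -- Scaling by `‖B v v‖^(-1/2)` leaves only the argument of `B v v`, which becomes the phase.
  obtain ⟨r, hr0, hrr⟩ : ∃ r : ℂ, r ≠ 0 ∧ conj r * r * ‖B v v‖ = 1 := by
    refine ⟨((√‖B v v‖)⁻¹ : ℝ), ?_, ?_⟩
    · rw [Ne, ofReal_eq_zero, inv_eq_zero]
      exact (Real.sqrt_pos.mpr hn).ne'
    · rw [conj_ofReal, ← ofReal_mul, ← ofReal_mul, ← mul_inv, Real.mul_self_sqrt hn.le,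
        inv_mul_cancel₀ hn.ne', ofReal_one]
  let f : Empty ⊕ (Unit ⊕ (Fin 2 × Empty)) → V := fun _ => r • v
  have hval : B (r • v) (r • v) = exp ((B v v).arg * I) := by
    simp only [map_smulₛₗ, LinearMap.smul_apply, RingHom.id_apply, smul_eq_mul]
    rw [← mul_assoc, mul_comm r]
    conv_lhs => rw [← norm_mul_exp_arg_mul_I (B v v)]
    rw [← mul_assoc, hrr, one_mul]
  have hc := isCompl_rightPerp (B := B) (f := f) (by
    intro c hc
    have h1 := hc (.inr (.inl ()))
    simp only [f, hval, Fintype.sum_sum_type, Finset.univ_eq_empty, Finset.sum_empty,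
      Finset.univ_unique, Finset.sum_singleton, zero_add, add_zero] at h1
    have h2 := (mul_eq_zero.mp h1).resolve_right (exp_ne_zero _)
    ext (i | i | i)
    · exact i.elim
    · exact h2
    · exact i.2.elim)
  have hmem : ∀ x ∈ rightPerp B f, B v x = 0 := by
    intro x hx
    have := mem_rightPerp.mp hx (.inr (.inl ()))
    simpa [f, hr0] using this
  refine HasCanonicalBasis.of_isCompl (θ := fun _ : Unit => (B v v).arg) (f := f)
    (fun _ => abs_arg_le_pi_div_two_iff.mpr hre) hc.1 ?_ hc.2 ?_ ?_ (h _ fun hvU => hv (hmem v hvU))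
  · rintro (i | i | i) (j | j | j)
    all_goals first | exact i.elim | exact j.elim | exact i.2.elim | exact j.2.elim | skip
    simp only [f, canonicalEntry, if_true, hval]
  · intro i u hu
    simp [f, hmem u hu]
  · intro i u hu
    simp [f, hperp u (hmem u hu)]

/-- Splitting off a vector in the radical. -/
theorem HasCanonicalBasis.of_radical {B : V →ₗ⋆[ℂ] V →ₗ[ℂ] ℂ} {v : V} (hv : v ≠ 0)
    (hl : ∀ x, B v x = 0) (hr : ∀ x, B x v = 0)
    (h : ∀ U : Submodule ℂ V, v ∉ U → HasCanonicalBasis (B.domRestrict₁₂ U U)) :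
    HasCanonicalBasis B := by
  let f : Unit ⊕ (Empty ⊕ (Fin 2 × Empty)) → V := fun _ => v
  have hf : LinearIndependent ℂ f := by
    rw [Fintype.linearIndependent_iff]
    intro c hc
    simp only [f, Fintype.sum_sum_type, Finset.univ_eq_empty, Finset.sum_empty,
      Finset.univ_unique, Finset.sum_singleton, add_zero] at hc
    rintro (i | i | i)
    · exact (smul_eq_zero.mp hc).resolve_right hv
    · exact i.elim
    · exact i.2.elim
  obtain ⟨U, hU⟩ := Submodule.exists_isCompl (Submodule.span ℂ (Set.range f))
  refine HasCanonicalBasis.of_isCompl (θ := fun i : Empty => i.elim) (f := f)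
    (fun i => i.elim) hf ?_ hU ?_ ?_ (h U fun hvU => hv ?_)
  · rintro (i | i | i) (j | j | j)
    all_goals first | exact i.elim | exact j.elim | exact i.2.elim | exact j.2.elim | skip
    exact hl v
  · intro i u hu
    exact hl u
  · intro i u hu
    exact hr u
  · exact Submodule.disjoint_def.mp hU.disjoint v (Submodule.subset_span ⟨.inl (), rfl⟩) hvU

/-- Splitting off a pair of vectors with Gram matrix `[1 2; 0 1]`. -/
theorem HasCanonicalBasis.of_pair {B : V →ₗ⋆[ℂ] V →ₗ[ℂ] ℂ} {v : Fin 2 → V}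
    (hv : ∀ i j, B (v i) (v j) = (!![1, 2; 0, 1] : Matrix (Fin 2) (Fin 2) ℂ) i j)
    (hperp : ∀ x, (∀ i, B (v i) x = 0) → ∀ i, B x (v i) = 0)
    (h : ∀ U : Submodule ℂ V, v 0 ∉ U → HasCanonicalBasis (B.domRestrict₁₂ U U)) :
    HasCanonicalBasis B := by
  let f : Empty ⊕ (Empty ⊕ (Fin 2 × Unit)) → V :=
    Sum.elim Empty.elim (Sum.elim Empty.elim fun x => v x.1)
  have hc := isCompl_rightPerp (B := B) (f := f) (by
    intro c hc
    have h1 := hc (.inr (.inr (0, ())))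
    have h2 := hc (.inr (.inr (1, ())))
    simp [f, Fintype.sum_prod_type, hv] at h1 h2
    rw [h2] at h1
    ext (i | i | ⟨i, k⟩)
    · exact i.elim
    · exact i.elim
    · fin_cases i
      · simpa using h1
      · exact h2)
  have hmem : ∀ x ∈ rightPerp B f, ∀ i, B (v i) x = 0 := by
    intro x hx i
    exact mem_rightPerp.mp hx (.inr (.inr (i, ())))
  refine HasCanonicalBasis.of_isCompl (θ := fun i : Empty => i.elim) (f := f)
    (fun i => i.elim) hc.1 ?_ hc.2 ?_ ?_ (h _ fun hvU => ?_)
  · rintro (i | i | i) (j | j | j)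
    all_goals first | exact i.elim | exact j.elim | skip
    simp [f, canonicalEntry, hv]
  · rintro (i | i | i) u hu
    · exact i.elim
    · exact i.elim
    · exact hmem u hu i.1
  · rintro (i | i | i) u hu
    · exact i.elim
    · exact i.elim
    · exact hperp u (hmem u hu) i.1
  · have := hmem _ hvU 0
    simp [hv] at this

end Splitting

/-! ### Canonical bases of forms with positive semidefinite Hermitian part. -/

section Existence

variable {V : Type*} [AddCommGroup V] [Module ℂ V]

/-- A vector of zero length for a positive semidefinite Hermitian form lies in its radical. -/
theorem eq_zero_of_re_apply_self_eq_zero {H : V →ₗ⋆[ℂ] V →ₗ[ℂ] ℂ}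
    (hH : ∀ x y, conj (H x y) = H y x) (hpos : ∀ x, 0 ≤ (H x x).re) {v : V}
    (hv : (H v v).re = 0) (x : V) : H v x = 0 := by
  -- Expanding at `x + t H(v,x) v`, the term in `t²` carries `H v v = 0`. An affine function of `t`
  -- that is nonnegative everywhere has slope zero.
  have key : ∀ t : ℝ, 0 ≤ (H x x).re + 2 * t * normSq (H v x) := by
    intro t
    have h1 := hpos (x + (t * H v x) • v)
    have h2 : (H (x + (t * H v x) • v) (x + (t * H v x) • v)).re =
        (H x x).re + 2 * t * normSq (H v x) := by
      have hvx := hH v x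
      have h3 : (H v v).im = 0 := by
        have := congrArg im (hH v v)
        rw [conj_im] at this
        linarith
      simp only [map_add, LinearMap.add_apply, map_smulₛₗ, LinearMap.smul_apply, RingHom.id_apply,
        smul_eq_mul, ← hvx]
      simp [normSq_apply, hv, h3]
      ring
    rwa [h2] at h1
  by_contra hne
  have hn := normSq_pos.mpr hne
  have := key (-((H x x).re + 1) / (2 * normSq (H v x)))
  have h4 : 2 * (-((H x x).re + 1) / (2 * normSq (H v x))) * normSq (H v x) =
      -((H x x).re + 1) := by
    field_simp
  rw [h4] at this
  linarith

/-- The functionals vanishing on the radical of a Hermitian form are represented by the form. -/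
theorem exists_apply_eq [FiniteDimensional ℂ V] {H : V →ₗ⋆[ℂ] V →ₗ[ℂ] ℂ}
    (hH : ∀ x y, conj (H x y) = H y x) (l : Dual ℂ V)
    (hl : ∀ v, (∀ x, H v x = 0) → l v = 0) : ∃ w, H w = l := by
  -- The coannihilator of the range is the radical, and in finite dimension a subspace of the dual
  -- is its own double annihilator.
  have h1 : l ∈ (LinearMap.range H).dualCoannihilator.dualAnnihilator := by
    rw [Submodule.mem_dualAnnihilator]
    intro v hv
    refine hl v fun x => ?_
    rw [Submodule.mem_dualCoannihilator] at hv
    rw [← hH, hv (H x) ⟨x, rfl⟩, map_zero]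
  rw [Subspace.dualCoannihilator_dualAnnihilator_eq] at h1
  exact h1

/-- A pair of vectors spanning a block in which the Hermitian part degenerates. -/
theorem HasCanonicalBasis.of_kernel [FiniteDimensional ℂ V] {H K : V →ₗ⋆[ℂ] V →ₗ[ℂ] ℂ}
    (hH : ∀ x y, conj (H x y) = H y x) (hK : ∀ x y, conj (K x y) = K y x)
    (hpos : ∀ x, 0 ≤ (H x x).re)
    (hiso : ∀ v, (∀ x, H v x = 0) → K v v = 0) {v : V} (hv : ∀ x, H v x = 0) {y : V}
    (hvy : K v y ≠ 0)
    (h : ∀ U : Submodule ℂ V, U ≠ ⊤ → HasCanonicalBasis ((H + I • K).domRestrict₁₂ U U)) :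
    HasCanonicalBasis (H + I • K) := by
  -- Polarization on the radical of `H`, where `K` is isotropic: test `v + c u` with `c = 1` and `c
  -- = i`. Thus `K v` vanishes on the radical and is represented as `H w`.
  have hpol : ∀ u, (∀ x, H u x = 0) → K v u = 0 := by
    intro u hu
    have h1 : ∀ c : ℂ, c * K v u + conj c * conj (K v u) = 0 := by
      intro c
      have := hiso (v + c • u) fun x => by simp [hv, hu]
      simp only [map_add, LinearMap.add_apply, map_smulₛₗ, LinearMap.smul_apply, RingHom.id_apply,
        smul_eq_mul, hiso v hv, hiso u hu, ← hK v u, mul_zero, add_zero, zero_add] at this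
      rw [add_comm]
      simpa [add_comm] using this
    have h2 := h1 1
    have h3 := h1 I
    simp only [one_mul, map_one, conj_I] at h2 h3
    have h4 : 2 * K v u = 0 := by linear_combination h2 - I * h3 + (K v u - conj (K v u)) * I_mul_I
    simpa using h4
  obtain ⟨w, hw⟩ := exists_apply_eq hH (K v) hpol
  have hwx : ∀ x, H w x = K v x := fun x => by rw [hw]
  have hHr : ∀ x, H x v = 0 := fun x => by rw [← hH, hv, map_zero]
  have hKr : ∀ x, K x v = conj (K v x) := fun x => (hK v x).symm
  have him : (H w w).im = 0 := by
    have := congrArg im (hH w w)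
    rw [conj_im] at this
    linarith
  have hre : (H w w).re ≠ 0 := by
    intro h0
    exact hvy (by rw [← hwx]; exact eq_zero_of_re_apply_self_eq_zero hH hpos h0 y)
  have hre' : 0 < (H w w).re := lt_of_le_of_ne (hpos w) hre.symm
  set a : ℝ := (H w w).re with ha
  have hww : H w w = a := Complex.ext rfl (by simp [him])
  obtain ⟨k, hk⟩ : ∃ k : ℝ, K w w = k := by
    refine ⟨(K w w).re, Complex.ext rfl ?_⟩
    have := congrArg im (hK w w)
    rw [conj_im] at this
    rw [ofReal_im]
    linarith
  have hvw : K v w = a := by rw [← hwx, hww]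
  have hwv : K w v = a := by rw [hKr, hvw, conj_ofReal]
  have hvv : K v v = 0 := hiso v hv
  obtain ⟨s, hs0, hs⟩ : ∃ s : ℝ, s ≠ 0 ∧ s * s * a = 1 := by
    refine ⟨(√a)⁻¹, inv_ne_zero (Real.sqrt_pos.mpr hre').ne', ?_⟩
    rw [← mul_inv, Real.mul_self_sqrt hre'.le, inv_mul_cancel₀ hre]
  have hs' : (s : ℂ) * s * a = 1 := by exact_mod_cast hs
  have hsc : (s : ℂ) ≠ 0 := ofReal_ne_zero.mpr hs0
  have hac : (a : ℂ) ≠ 0 := ofReal_ne_zero.mpr hre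
  have hgram : ∀ c d : ℂ, (H + I • K) ((s : ℂ) • (w + c • v)) ((s : ℂ) • (w + d • v)) =
      1 + I * (k / a + d + conj c) := by
    intro c d
    simp only [map_add, LinearMap.add_apply, map_smulₛₗ, LinearMap.smul_apply, RingHom.id_apply,
      smul_eq_mul, hww, hk, hvw, hwv, hvv, hHr, hv, conj_ofReal]
    field_simp
    linear_combination (a + I * (k + a * (d + conj c))) * hs'
  -- The real parts cancel `k / a` in `hgram`; the imaginary parts make `d + conj c` contribute `0`
  -- on the diagonal and `∓i` off it, giving the entries `2` and `0`.
  let c : Fin 2 → ℂ := ![-k / (2 * a) + I / 2, -k / (2 * a) - I / 2]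
  let f : Fin 2 → V := fun i => (s : ℂ) • (w + c i • v)
  have hI := I_mul_I
  have hc0 : conj (c 0) = -k / (2 * a) - I / 2 := by
    have h2 : conj (2 : ℂ) = 2 := conj_ofNat 2
    simp [c, h2]
    ring
  have hc1 : conj (c 1) = -k / (2 * a) + I / 2 := by
    have h2 : conj (2 : ℂ) = 2 := conj_ofNat 2
    simp [c, h2]
    ring
  refine HasCanonicalBasis.of_pair (v := f) ?_ ?_ fun U hU => h U fun hT => hU (hT ▸ trivial)
  · intro i j
    simp only [f, hgram]
    have hk2 : (k / a : ℂ) + -k / (2 * a) + -k / (2 * a) = 0 := by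
      field_simp
      ring
    fin_cases i <;> fin_cases j <;> simp only [Fin.zero_eta, Fin.mk_one, hc0, hc1] <;> simp [c]
    · linear_combination I * hk2
    · linear_combination I * hk2 - hI
    · linear_combination I * hk2 + hI
    · linear_combination I * hk2
  · intro x hx
    have h0 := hx 0
    have h1 := hx 1
    simp only [f, map_add, LinearMap.add_apply, map_smulₛₗ, LinearMap.smul_apply, smul_eq_mul,
      conj_ofReal, hv, hwx, mul_eq_zero, hsc, false_or] at h0 h1
    -- Since `H w x = K v x`, subtracting the two orthogonality relations isolates `K v x`; then `H
    -- w x` and `K w x` vanish too, and Hermitian symmetry gives orthogonality on the other side.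
    have hc : conj (c 0) - conj (c 1) = -I := by
      rw [hc0, hc1]
      ring
    have h2 : K v x = 0 := by
      have : (conj (c 0) - conj (c 1)) * (I * K v x) = 0 := by linear_combination h0 - h1
      rw [hc] at this
      linear_combination this + K v x * hI
    have h3 : K w x = 0 := by
      rw [h2] at h0
      have : I * K w x = 0 := by linear_combination h0
      exact (mul_eq_zero.mp this).resolve_left I_ne_zero
    intro i
    simp only [f, map_add, LinearMap.add_apply, map_smulₛₗ, LinearMap.smul_apply,
      RingHom.id_apply, smul_eq_mul, hHr, hKr, h2, ← hH w x, ← hK w x, hwx, h3, map_zero, mul_zero,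
      add_zero]

/-- Every form with positive semidefinite Hermitian part has a canonical basis. -/
theorem hasCanonicalBasis_of_nonneg (d : ℕ) : ∀ {V : Type*} [AddCommGroup V] [Module ℂ V]
    [FiniteDimensional ℂ V] (H K : V →ₗ⋆[ℂ] V →ₗ[ℂ] ℂ),
    (∀ x y, conj (H x y) = H y x) → (∀ x y, conj (K x y) = K y x) → (∀ x, 0 ≤ (H x x).re) →
    finrank ℂ V = d → HasCanonicalBasis (H + I • K) := by
  induction d using Nat.strong_induction_on with
  | _ d ih =>
  intro V _ _ _ H K hH hK hpos hd
  have IH : ∀ U : Submodule ℂ V, U ≠ ⊤ → HasCanonicalBasis ((H + I • K).domRestrict₁₂ U U) := by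
    intro U hU
    refine ih (finrank ℂ U) (hd ▸ Submodule.finrank_lt hU) (V := U)
      (H.domRestrict₁₂ U U) (K.domRestrict₁₂ U U) (fun x y => hH x y) (fun x y => hK x y)
      (fun x => hpos x) rfl
  have IH' : ∀ (v : V) (U : Submodule ℂ V), v ∉ U →
      HasCanonicalBasis ((H + I • K).domRestrict₁₂ U U) :=
    fun v U hv => IH U fun hT => hv (hT ▸ trivial)
  -- A vector of the radical of `H` with `K v v ≠ 0` splits off with phase `±π/2`. If `K` is
  -- isotropic on a nonzero radical, a radical vector yields a block `[1 2; 0 1]` or a zero.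
  -- Otherwise `H` is definite.
  by_cases hiso : ∀ v, (∀ x, H v x = 0) → K v v = 0
  swap
  · push Not at hiso
    obtain ⟨v, hv, hKv⟩ := hiso
    refine HasCanonicalBasis.of_vector (v := v) ?_ ?_ ?_ (IH' v)
    · simpa [hv] using hKv
    · have := congrArg im (hK v v)
      rw [conj_im] at this
      have : (K v v).im = 0 := by linarith
      simp [hv, this]
    · intro x hx
      simp only [LinearMap.add_apply, LinearMap.smul_apply, hv, zero_add, smul_eq_mul,
        mul_eq_zero, I_ne_zero, false_or] at hx
      simp [← hH v x, ← hK v x, hv, hx]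
  by_cases hker : ∃ v, v ≠ 0 ∧ ∀ x, H v x = 0
  · obtain ⟨v, hv0, hv⟩ := hker
    by_cases hy : ∃ y, K v y ≠ 0
    · obtain ⟨y, hy⟩ := hy
      exact HasCanonicalBasis.of_kernel hH hK hpos hiso hv hy IH
    · push Not at hy
      refine HasCanonicalBasis.of_radical hv0 ?_ ?_ (IH' v)
      · intro x
        simp [hv, hy]
      · intro x
        simp [← hH v x, ← hK v x, hv, hy]
  push Not at hker
  rcases subsingleton_or_nontrivial V with hV | hV
  · exact ⟨Empty, Empty, Empty, inferInstance, inferInstance, inferInstance, fun i => i.elim,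
      Basis.empty V, fun i => i.elim, fun i => isEmptyElim i⟩
  have hbij : Function.Bijective H := by
    constructor
    · rw [← LinearMap.ker_eq_bot, LinearMap.ker_eq_bot']
      intro v hv
      by_contra hv0
      obtain ⟨x, hx⟩ := hker v hv0
      exact hx (by rw [hv, LinearMap.zero_apply])
    · intro l
      refine exists_apply_eq hH l fun v hv => ?_
      by_cases hv0 : v = 0
      · rw [hv0, map_zero]
      · obtain ⟨x, hx⟩ := hker v hv0
        exact absurd (hv x) hx
  let e := LinearEquiv.ofBijective H hbij
  -- For definite `H`, the operator `H⁻¹K` is linear, being a composite of two conjugate-linear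
  -- maps. It is `H`-self-adjoint, so an eigenvector has a real eigenvalue `l`, and `(H + iK) v = (1
  -- + i l) H v`.
  let A : V →ₗ[ℂ] V := (e.symm : Dual ℂ V →ₗ⋆[ℂ] V).comp K
  obtain ⟨μ, hμ⟩ := Module.End.exists_eigenvalue A
  obtain ⟨v, hv⟩ := hμ.exists_hasEigenvector
  have hKv : ∀ x, K v x = conj μ * H v x := by
    intro x
    have h1 : H (A v) = K v := e.apply_symm_apply (K v)
    rw [hv.apply_eq_smul, map_smulₛₗ] at h1
    rw [← h1]
    rfl
  have hre : (H v v).re ≠ 0 := by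
    intro h0
    obtain ⟨x, hx⟩ := hker v hv.2
    exact hx (eq_zero_of_re_apply_self_eq_zero hH hpos h0 x)
  have him : (H v v).im = 0 := by
    have := congrArg im (hH v v)
    rw [conj_im] at this
    linarith
  have hvv : H v v = ((H v v).re : ℂ) := Complex.ext rfl (by simp [him])
  have hμ' : conj μ = μ := by
    have h1 := hK v v
    rw [hKv v, map_mul, hH, conj_conj] at h1
    have h2 : H v v ≠ 0 := fun h => hre (by rw [h, zero_re])
    exact (mul_right_cancel₀ h2 h1).symm
  obtain ⟨l, rfl⟩ := conj_eq_iff_real.mp hμ'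
  rw [conj_ofReal] at hKv
  have hfac : ∀ x, (H + I • K) v x = (1 + I * l) * H v x := by
    intro x
    simp only [LinearMap.add_apply, LinearMap.smul_apply, hKv, smul_eq_mul]
    ring
  have hl : (1 + I * l : ℂ) ≠ 0 := by
    intro h
    have := congrArg re h
    simp at this
  refine HasCanonicalBasis.of_vector (v := v) ?_ ?_ ?_ (IH' v)
  · rw [hfac]
    exact mul_ne_zero hl fun h => hre (by rw [h, zero_re])
  · rw [hfac]
    simpa [him] using hpos v
  · intro x hx
    rw [hfac] at hx
    have hx' := (mul_eq_zero.mp hx).resolve_left hl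
    simp [← hH v x, ← hK v x, hKv, hx']

end Existence

/-! ### Existence of phases with a prescribed centre. -/

/-- `φ` is a selection of the phases of `C` with centre `θ₀`. -/
def IsPhasesAt {ι : Type*} [Fintype ι] [DecidableEq ι] (C : Matrix ι ι ℂ) (θ₀ : ℝ)
    (φ : Fin C.rank → ℝ) : Prop :=
  Antitone φ ∧
  ∃ (z m p : ℕ) (e : ι ≃ Fin z ⊕ (Fin m ⊕ (Fin 2 × Fin p))) (θ : Fin m → ℝ)
    (T : Matrix ι ι ℂ),
    IsUnit T ∧
    C = Tᴴ * (sectorialForm θ₀ θ).submatrix e e * T ∧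
    (∀ i, θ₀ - Real.pi / 2 ≤ θ i ∧ θ i ≤ θ₀ + Real.pi / 2) ∧
    Multiset.map φ Finset.univ.val =
      Multiset.map θ Finset.univ.val + Multiset.replicate p (θ₀ + Real.pi / 2) +
        Multiset.replicate p (θ₀ - Real.pi / 2)

theorem isPhases_iff {ι : Type*} [Fintype ι] [DecidableEq ι] {C : Matrix ι ι ℂ}
    {φ : Fin C.rank → ℝ} : IsPhases C φ ↔ ∃ θ₀, IsPhasesAt C θ₀ φ := by
  constructor
  · rintro ⟨h, z, m, p, e, θ₀, θ, T, h'⟩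
    exact ⟨θ₀, h, z, m, p, e, θ, T, h'⟩
  · rintro ⟨θ₀, h, z, m, p, e, θ, T, h'⟩
    exact ⟨h, z, m, p, e, θ₀, θ, T, h'⟩

/-- The sesquilinear form `(x, y) ↦ x* A y`. -/
noncomputable def sesqForm {ι : Type*} [Fintype ι] (A : Matrix ι ι ℂ) :
    (ι → ℂ) →ₗ⋆[ℂ] (ι → ℂ) →ₗ[ℂ] ℂ :=
  LinearMap.mk₂'ₛₗ (starRingEnd ℂ) (RingHom.id ℂ) (fun x y => star x ⬝ᵥ (A *ᵥ y))
    (fun x x' y => by rw [star_add, add_dotProduct])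
    (fun c x y => by rw [star_smul, smul_dotProduct]; rfl)
    (fun x y y' => by rw [Matrix.mulVec_add, dotProduct_add])
    (fun c x y => by rw [Matrix.mulVec_smul, dotProduct_smul]; rfl)

theorem sesqForm_apply {ι : Type*} [Fintype ι] (A : Matrix ι ι ℂ) (x y : ι → ℂ) :
    sesqForm A x y = star x ⬝ᵥ (A *ᵥ y) := rfl

theorem conj_sesqForm {ι : Type*} [Fintype ι] (A : Matrix ι ι ℂ) (x y : ι → ℂ) :
    conj (sesqForm A x y) = sesqForm Aᴴ y x := by
  rw [sesqForm_apply, sesqForm_apply, starRingEnd_apply, Matrix.star_dotProduct, star_star,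
    Matrix.star_mulVec, Matrix.dotProduct_mulVec]

/-- Every finite multiset of reals is listed by an antitone family. -/
theorem exists_antitone_map_eq {r : ℕ} (s : Multiset ℝ) (hs : s.card = r) :
    ∃ φ : Fin r → ℝ, Antitone φ ∧ Multiset.map φ Finset.univ.val = s := by
  subst hs
  have hlen : (s.sort (· ≥ ·)).length = s.card := Multiset.length_sort _
  refine ⟨fun i => (s.sort (· ≥ ·)).get (Fin.cast hlen.symm i), ?_, ?_⟩
  · intro i j hij
    have h := (Multiset.pairwise_sort s (· ≥ ·))
    rcases hij.eq_or_lt with rfl | hlt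
    · exact le_rfl
    · exact List.pairwise_iff_get.mp h _ _ hlt
  · rw [Fin.univ_val_map]
    conv_rhs => rw [← Multiset.sort_eq s (· ≥ ·)]
    congr 1
    apply List.ext_get
    · simp
    · intro i h1 h2
      simp

/-- The nonzero part `N = diag(D, E)` is invertible, and it and the full matrix are obtained from
each other by multiplication with rectangular matrices. This fixes the number of phases as the rank.
-/
theorem rank_sectorialForm {z m p : ℕ} (θ₀ : ℝ) (θ : Fin m → ℝ) :
    (sectorialForm θ₀ θ : Matrix (Fin z ⊕ (Fin m ⊕ (Fin 2 × Fin p))) _ ℂ).rank = m + 2 * p := by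
  set N : Matrix (Fin m ⊕ (Fin 2 × Fin p)) (Fin m ⊕ (Fin 2 × Fin p)) ℂ :=
    Matrix.fromBlocks
      (Matrix.diagonal fun i => Complex.exp ((θ i : ℂ) * Complex.I)) 0 0
      (Matrix.blockDiagonal fun _ : Fin p =>
        Complex.exp ((θ₀ : ℂ) * Complex.I) • !![(1 : ℂ), 2; 0, 1]) with hN
  have hu : IsUnit N := by
    rw [Matrix.isUnit_iff_isUnit_det, hN, Matrix.det_fromBlocks_zero₂₁, Matrix.det_diagonal,
      Matrix.det_blockDiagonal, isUnit_iff_ne_zero]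
    refine mul_ne_zero (Finset.prod_ne_zero_iff.mpr fun i _ => exp_ne_zero _)
      (Finset.prod_ne_zero_iff.mpr fun i _ => ?_)
    rw [Matrix.det_smul, Matrix.det_fin_two]
    simp
  have hrN : N.rank = m + 2 * p := by
    rw [Matrix.rank_of_isUnit N hu]
    simp
  let F : Matrix (Fin z ⊕ (Fin m ⊕ (Fin 2 × Fin p))) (Fin z ⊕ (Fin m ⊕ (Fin 2 × Fin p))) ℂ :=
    sectorialForm θ₀ θ
  let R : Matrix (Fin z ⊕ (Fin m ⊕ (Fin 2 × Fin p))) (Fin m ⊕ (Fin 2 × Fin p)) ℂ :=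
    Matrix.fromRows 0 (1 : Matrix (Fin m ⊕ (Fin 2 × Fin p)) (Fin m ⊕ (Fin 2 × Fin p)) ℂ)
  let L : Matrix (Fin m ⊕ (Fin 2 × Fin p)) (Fin z ⊕ (Fin m ⊕ (Fin 2 × Fin p))) ℂ :=
    Matrix.fromCols 0 (1 : Matrix (Fin m ⊕ (Fin 2 × Fin p)) (Fin m ⊕ (Fin 2 × Fin p)) ℂ)
  change F.rank = _
  have h1 : F = R * N * L := by
    simp only [F, R, L]
    rw [Matrix.fromRows_mul, Matrix.fromRows_mul, Matrix.mul_fromCols, Matrix.mul_fromCols,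
      Matrix.fromRows_fromCols_eq_fromBlocks]
    simp [sectorialForm, hN]
  have h2 : N = L * F * R := by
    simp only [F, R, L]
    rw [sectorialForm, ← hN, Matrix.fromCols_mul_fromBlocks, Matrix.fromCols_mul_fromRows]
    simp
  apply le_antisymm
  · rw [h1, ← hrN]
    exact (Matrix.rank_mul_le_left _ _).trans (Matrix.rank_mul_le_right _ _)
  · rw [← hrN]
    conv_lhs => rw [h2]
    exact (Matrix.rank_mul_le_left _ _).trans (Matrix.rank_mul_le_right _ _)

/-- A matrix whose numerical range lies in the half-plane centred at the direction `θ₀` has a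
selection of phases with centre `θ₀`. -/
theorem exists_isPhasesAt {ι : Type*} [Fintype ι] [DecidableEq ι] (A : Matrix ι ι ℂ) (θ₀ : ℝ)
    (hA : ∀ x : ι → ℂ, 0 ≤ (exp (-θ₀ * I) * (star x ⬝ᵥ (A *ᵥ x))).re) :
    ∃ φ, IsPhasesAt A θ₀ φ := by
  set B : Matrix ι ι ℂ := exp (-θ₀ * I) • A with hB
  set H : (ι → ℂ) →ₗ⋆[ℂ] (ι → ℂ) →ₗ[ℂ] ℂ := sesqForm ((1 / 2 : ℂ) • (B + Bᴴ)) with hH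
  set K : (ι → ℂ) →ₗ⋆[ℂ] (ι → ℂ) →ₗ[ℂ] ℂ := sesqForm ((-I / 2 : ℂ) • (B - Bᴴ)) with hK
  have hHK : H + I • K = sesqForm B := by
    ext x y
    simp only [hH, hK, LinearMap.add_apply, LinearMap.smul_apply, sesqForm_apply,
      Matrix.smul_mulVec, dotProduct_smul, Matrix.add_mulVec, Matrix.sub_mulVec, dotProduct_add,
      dotProduct_sub, smul_eq_mul, LinearMap.comp_apply]
    linear_combination (-(1 / 2) * (star _ ⬝ᵥ (B *ᵥ _)) + (1 / 2) * (star _ ⬝ᵥ (Bᴴ *ᵥ _))) * I_mul_I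
  have hBc := hasCanonicalBasis_of_nonneg (finrank ℂ (ι → ℂ)) H K ?_ ?_ ?_ rfl
  rotate_left
  · intro x y
    rw [hH, conj_sesqForm]
    congr 3
    rw [Matrix.conjTranspose_smul, Matrix.conjTranspose_add, Matrix.conjTranspose_conjTranspose,
      add_comm]
    simp
  · intro x y
    rw [hK, conj_sesqForm]
    congr 3
    rw [Matrix.conjTranspose_smul, Matrix.conjTranspose_sub, Matrix.conjTranspose_conjTranspose,
      ← neg_sub B, smul_neg, ← neg_smul]
    congr 1
    simp
    ring
  · intro x
    have h1 := hA x
    have h2 : H x x = (1 / 2) * (sesqForm B x x + conj (sesqForm B x x)) := by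
      rw [conj_sesqForm]
      simp only [hH, sesqForm_apply, Matrix.smul_mulVec, dotProduct_smul, Matrix.add_mulVec,
        dotProduct_add, smul_eq_mul]
    have h3 : sesqForm B x x = exp (-θ₀ * I) * (star x ⬝ᵥ (A *ᵥ x)) := by
      rw [sesqForm_apply, hB, Matrix.smul_mulVec, dotProduct_smul, smul_eq_mul]
    rw [h2, h3, add_conj]
    simpa using h1
  rw [hHK] at hBc
  obtain ⟨Z, M, P, _, _, _, θ, b, hθ, hb⟩ := hBc
  let eZ := Fintype.equivFin Z
  let eM := Fintype.equivFin M
  let eP := Fintype.equivFin P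
  let σ : Z ⊕ (M ⊕ (Fin 2 × P)) ≃ Fin (Fintype.card Z) ⊕
      (Fin (Fintype.card M) ⊕ (Fin 2 × Fin (Fintype.card P))) :=
    eZ.sumCongr (eM.sumCongr ((Equiv.refl _).prodCongr eP))
  -- Adding `θ₀` undoes the rotation that turned `A` into `B`.
  let θ' : Fin (Fintype.card M) → ℝ := fun k => θ₀ + θ (eM.symm k)
  have hσ : ∀ i j, sectorialForm θ₀ θ' (σ i) (σ j) = exp (θ₀ * I) * canonicalEntry θ i j := by
    rintro (i | i | ⟨a, k⟩) (j | j | ⟨a', k'⟩) <;>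
      simp only [σ, sectorialForm, canonicalEntry, Equiv.sumCongr_apply, Sum.map_inl, Sum.map_inr,
        Matrix.fromBlocks_apply₁₁, Matrix.fromBlocks_apply₁₂, Matrix.fromBlocks_apply₂₁,
        Matrix.fromBlocks_apply₂₂, Matrix.zero_apply, mul_zero, Equiv.prodCongr_apply, Prod.map,
        Matrix.diagonal_apply, Matrix.blockDiagonal_apply, mul_ite,
        Matrix.smul_apply, smul_eq_mul, Equiv.coe_refl, id_eq]
    · by_cases hij : i = j
      · simp only [hij, if_true, θ', Equiv.symm_apply_apply, ofReal_add, add_mul, exp_add]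
      · rw [if_neg hij, if_neg fun h => hij (eM.injective h)]
    · by_cases hij : k = k'
      · simp only [hij, if_true]
      · rw [if_neg hij, if_neg fun h => hij (eP.injective h)]
  let g : ι ≃ Z ⊕ (M ⊕ (Fin 2 × P)) := (Pi.basisFun ℂ ι).indexEquiv b
  let b' : Basis ι ℂ (ι → ℂ) := b.reindex g.symm
  let Q : Matrix ι ι ℂ := (Pi.basisFun ℂ ι).toMatrix b'
  let T : Matrix ι ι ℂ := b'.toMatrix (Pi.basisFun ℂ ι)
  have hQT : Q * T = 1 := Basis.toMatrix_mul_toMatrix_flip _ _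
  have hTQ : T * Q = 1 := Basis.toMatrix_mul_toMatrix_flip _ _
  have hform : (sectorialForm θ₀ θ').submatrix (g.trans σ) (g.trans σ) = Qᴴ * A * Q := by
    ext i j
    have h1 : (Qᴴ * A * Q) i j = sesqForm A (b (g i)) (b (g j)) := by
      have hcol : ∀ k l, Q l k = b (g k) l := by
        intro k l
        simp [Q, b', Basis.toMatrix_apply]
      rw [sesqForm_apply, Matrix.mul_assoc, Matrix.mul_apply, dotProduct]
      simp only [Matrix.conjTranspose_apply, hcol, Pi.star_apply, Matrix.mul_apply, Matrix.mulVec,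
        dotProduct]
    have h2 : sesqForm A (b (g i)) (b (g j)) =
        exp (θ₀ * I) * sesqForm B (b (g i)) (b (g j)) := by
      simp only [sesqForm_apply, hB, Matrix.smul_mulVec, dotProduct_smul, smul_eq_mul]
      rw [← mul_assoc, ← exp_add]
      simp
    rw [h1, h2, hb, Matrix.submatrix_apply]
    exact hσ (g i) (g j)
  have hAT : A = Tᴴ * (sectorialForm θ₀ θ').submatrix (g.trans σ) (g.trans σ) * T := by
    have hTQ' : Tᴴ * Qᴴ = 1 := by
      rw [← Matrix.conjTranspose_mul, hQT, Matrix.conjTranspose_one]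
    rw [hform]
    calc A = (Tᴴ * Qᴴ) * A * (Q * T) := by rw [hTQ', hQT, Matrix.one_mul, Matrix.mul_one]
      _ = _ := by simp only [Matrix.mul_assoc]
  have hT : IsUnit T := ⟨⟨T, Q, hTQ, hQT⟩, rfl⟩
  have hrank : A.rank = Fintype.card M + 2 * Fintype.card P := by
    rw [hAT, Matrix.rank_mul_eq_left_of_isUnit_det _ _ ((Matrix.isUnit_iff_isUnit_det _).mp hT),
      Matrix.rank_mul_eq_right_of_isUnit_det, Matrix.rank_submatrix, rank_sectorialForm]
    rw [Matrix.det_conjTranspose]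
    exact ((Matrix.isUnit_iff_isUnit_det _).mp hT).star
  obtain ⟨φ, hφ, hφs⟩ := exists_antitone_map_eq (r := A.rank)
    (Multiset.map θ' Finset.univ.val + Multiset.replicate (Fintype.card P) (θ₀ + Real.pi / 2) +
        Multiset.replicate (Fintype.card P) (θ₀ - Real.pi / 2)) (by
      rw [hrank]
      simp
      ring)
  refine ⟨φ, hφ, _, _, _, g.trans σ, θ', T, hT, hAT, fun i => ?_, hφs⟩
  have := abs_le.mp (hθ (eM.symm i))
  constructor <;> simp only [θ'] <;> linarith

/-! ### The quadratic form of a canonical matrix. -/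

theorem dotProduct_sectorialForm {z m p : ℕ} (θ₀ : ℝ) (θ : Fin m → ℝ)
    (y : Fin z ⊕ (Fin m ⊕ (Fin 2 × Fin p)) → ℂ) :
    star y ⬝ᵥ (sectorialForm θ₀ θ *ᵥ y) =
      (∑ i, exp (θ i * I) * normSq (y (.inr (.inl i)))) +
      ∑ k, exp (θ₀ * I) * (normSq (y (.inr (.inr (0, k)))) + normSq (y (.inr (.inr (1, k)))) +
        2 * conj (y (.inr (.inr (0, k)))) * y (.inr (.inr (1, k)))) := by
  have h1 : ∀ i : Fin m, ∑ j, (if i = j then exp (θ i * I) else 0) * y (.inr (.inl j)) =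
      exp (θ i * I) * y (.inr (.inl i)) := by
    intro i
    simp
  have h2 : ∀ (c : Fin 2 → Fin 2 → ℂ) (a b : Fin 2) (k : Fin p),
      ∑ l, (if k = l then c a b else 0) * y (.inr (.inr (b, l))) =
        c a b * y (.inr (.inr (b, k))) := by
    intro c a b k
    simp
  simp only [dotProduct, Matrix.mulVec, Fintype.sum_sum_type, Fintype.sum_prod_type,
    sectorialForm, Matrix.fromBlocks_apply₁₁, Matrix.fromBlocks_apply₁₂,
    Matrix.fromBlocks_apply₂₁, Matrix.fromBlocks_apply₂₂, Matrix.zero_apply, zero_mul,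
    Finset.sum_const_zero, mul_zero, zero_add, add_zero, Matrix.diagonal_apply,
    Matrix.blockDiagonal_apply, Matrix.smul_apply, h1, Fin.sum_univ_two, Pi.star_apply]
  rw [← Finset.sum_add_distrib]
  congr 1
  · refine Finset.sum_congr rfl fun i _ => ?_
    rw [normSq_eq_conj_mul_self, starRingEnd_apply]
    ring
  · refine Finset.sum_congr rfl fun k _ => ?_
    simp only [normSq_eq_conj_mul_self, starRingEnd_apply, h2 fun a b => exp (θ₀ * I) •
      (!![(1 : ℂ), 2; 0, 1] : Matrix (Fin 2) (Fin 2) ℂ) a b]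
    simp
    ring

theorem dotProduct_congr_sectorialForm {ι : Type*} [Fintype ι] {z m p : ℕ}
    (e : ι ≃ Fin z ⊕ (Fin m ⊕ (Fin 2 × Fin p))) (θ₀ : ℝ) (θ : Fin m → ℝ) (T : Matrix ι ι ℂ)
    (x : ι → ℂ) :
    star x ⬝ᵥ ((Tᴴ * (sectorialForm θ₀ θ).submatrix e e * T) *ᵥ x) =
      star ((T *ᵥ x) ∘ e.symm) ⬝ᵥ (sectorialForm θ₀ θ *ᵥ ((T *ᵥ x) ∘ e.symm)) := by
  rw [← Matrix.mulVec_mulVec, ← Matrix.mulVec_mulVec, Matrix.dotProduct_mulVec,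
    ← Matrix.star_mulVec, Matrix.submatrix_mulVec_equiv]
  simp only [dotProduct]
  rw [← e.sum_comp]
  simp

/-- The imaginary part of the rotated quadratic form of a canonical matrix. -/
theorem im_exp_mul_sectorialForm {z m p : ℕ} (θ₀ α s : ℝ) (θ : Fin m → ℝ)
    (y : Fin z ⊕ (Fin m ⊕ (Fin 2 × Fin p)) → ℂ) :
    s * (exp (-α * I) * (star y ⬝ᵥ (sectorialForm θ₀ θ *ᵥ y))).im =
      (∑ i, normSq (y (.inr (.inl i))) * (s * Real.sin (θ i - α))) +
      ∑ k, s * (exp ((θ₀ - α : ℝ) * I) * (normSq (y (.inr (.inr (0, k)))) +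
        normSq (y (.inr (.inr (1, k)))) +
        2 * conj (y (.inr (.inr (0, k)))) * y (.inr (.inr (1, k))))).im := by
  rw [dotProduct_sectorialForm, mul_add, add_im, Finset.mul_sum, Finset.mul_sum, im_sum, im_sum,
    mul_add, Finset.mul_sum, Finset.mul_sum]
  have hexp : ∀ t : ℝ, exp (-α * I) * exp (t * I) = exp ((t - α : ℝ) * I) := by
    intro t
    rw [← exp_add, ofReal_sub]
    ring_nf
  congr 1
  · refine Finset.sum_congr rfl fun i _ => ?_
    rw [← mul_assoc, hexp, im_mul_ofReal, exp_ofReal_mul_I_im]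
    ring
  · refine Finset.sum_congr rfl fun k _ => ?_
    rw [← mul_assoc, hexp]

/-- The rotated quadratic form of the block `[1 2; 0 1]` on the vector `(u, (-1 + iτ) u)`. -/
theorem im_exp_mul_block (β τ : ℝ) (u : ℂ) :
    (exp ((β : ℝ) * I) * (normSq u + normSq ((-1 + τ * I) * u) +
        2 * conj u * ((-1 + τ * I) * u))).im =
      normSq u * (τ ^ 2 * Real.sin β + 2 * τ * Real.cos β) := by
  -- At `τ = 0` the vector is isotropic for the block; `τ` moves the value to `(τ² + 2iτ)|u|²`,
  -- whose sign can be steered.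
  have h1 : (normSq u + normSq ((-1 + τ * I) * u) + 2 * conj u * ((-1 + τ * I) * u) : ℂ) =
      normSq u * (τ ^ 2 + 2 * τ * I) := by
    have h2 : (normSq (-1 + τ * I : ℂ) : ℂ) = 1 + τ ^ 2 := by
      rw [normSq_apply]
      simp
      ring
    rw [normSq_mul, ofReal_mul, h2]
    linear_combination (-2 + 2 * τ * I) * (normSq_eq_conj_mul_self (z := u)).symm
  rw [h1, exp_mul_I, ← ofReal_cos, ← ofReal_sin]
  generalize Real.cos β = c
  generalize Real.sin β = d
  simp [pow_two]
  ring

/-! ### Inertia counts and interlacing. -/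

section Inertia

variable {ι : Type*} [Fintype ι] [DecidableEq ι] {C : Matrix ι ι ℂ} {θ₀ : ℝ}
  {φ : Fin C.rank → ℝ}

theorem IsPhasesAt.mem_Icc (h : IsPhasesAt C θ₀ φ) (i : Fin C.rank) :
    θ₀ - Real.pi / 2 ≤ φ i ∧ φ i ≤ θ₀ + Real.pi / 2 := by
  obtain ⟨-, z, m, p, e, θ, T, -, -, hθ, hφ⟩ := h
  have hmem : φ i ∈ Multiset.map φ Finset.univ.val :=
    Multiset.mem_map_of_mem _ (Finset.mem_univ i)
  have := Real.pi_pos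
  rw [hφ, Multiset.mem_add, Multiset.mem_add] at hmem
  rcases hmem with (h | h) | h
  · obtain ⟨j, -, hj⟩ := Multiset.mem_map.mp h
    rw [← hj]
    exact hθ j
  · rw [Multiset.eq_of_mem_replicate h]
    constructor <;> linarith
  · rw [Multiset.eq_of_mem_replicate h]
    constructor <;> linarith

/-- As `α` lies strictly between `θ₀ - π/2` and `θ₀ + π/2`, every block of `E` has exactly one of
its two phases on each side of `α`. The sign `s` selects the side. -/
theorem card_pos_phases {r m p : ℕ} {φ : Fin r → ℝ} {θ : Fin m → ℝ}
    (hφ : Multiset.map φ Finset.univ.val =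
      Multiset.map θ Finset.univ.val + Multiset.replicate p (θ₀ + Real.pi / 2) +
        Multiset.replicate p (θ₀ - Real.pi / 2)) {s α : ℝ} (hs : s = 1 ∨ s = -1)
    (hα : θ₀ - Real.pi / 2 < α) (hα' : α < θ₀ + Real.pi / 2) :
    Fintype.card ({i : Fin m // 0 < s * (θ i - α)} ⊕ Fin p) =
      Fintype.card {i : Fin r // 0 < s * (φ i - α)} := by
  classical
  have hc : ∀ {n : ℕ} (f : Fin n → ℝ), Fintype.card {i : Fin n // 0 < s * (f i - α)} =
      Multiset.countP (fun t : ℝ => 0 < s * (t - α)) (Multiset.map f Finset.univ.val) := by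
    intro n f
    rw [Fintype.card_subtype, Multiset.countP_map]
    rfl
  rw [Fintype.card_sum, hc, hc, hφ, Multiset.countP_add, Multiset.countP_add, Fintype.card_fin,
    add_assoc]
  congr 1
  have hrep : ∀ t : ℝ, Multiset.countP (fun t : ℝ => 0 < s * (t - α)) (Multiset.replicate p t) =
      if 0 < s * (t - α) then p else 0 := by
    intro t
    rw [← Multiset.coe_replicate, Multiset.coe_countP, List.countP_replicate]
    simp
  rw [hrep, hrep]
  rcases hs with rfl | rfl
  · rw [if_pos (by linarith), if_neg (by linarith), add_zero]
  · rw [if_neg (by linarith), if_pos (by linarith), zero_add]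

/-- Used with `t = θ i - α`: the angles of `D` lie in the closed half-circle and `α` in its
interior, so `|t| < π`. -/
theorem mul_sin_pos_iff {s t : ℝ} (hs : s = 1 ∨ s = -1) (ht : -Real.pi < t) (ht' : t < Real.pi) :
    0 < s * Real.sin t ↔ 0 < s * t := by
  rcases lt_trichotomy t 0 with h | h | h
  · have := Real.sin_neg_of_neg_of_neg_pi_lt h ht
    rcases hs with rfl | rfl <;> constructor <;> intro <;> linarith
  · simp [h]
  · have := Real.sin_pos_of_pos_of_lt_pi h ht'
    rcases hs with rfl | rfl <;> constructor <;> intro <;> linarith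

/-- There is a space of dimension the number of phases on one side of `α` on which the imaginary
part of the rotated quadratic form is definite. -/
theorem IsPhasesAt.exists_definite (h : IsPhasesAt C θ₀ φ) {s α : ℝ} (hs : s = 1 ∨ s = -1)
    (hα : θ₀ - Real.pi / 2 < α) (hα' : α < θ₀ + Real.pi / 2) :
    ∃ (J : Type) (_ : Fintype J) (G : (J → ℂ) →ₗ[ℂ] (ι → ℂ)),
      Fintype.card J = Fintype.card {i // 0 < s * (φ i - α)} ∧
      ∀ c, c ≠ 0 → 0 < s * (exp (-α * I) * (star (G c) ⬝ᵥ (C *ᵥ G c))).im := by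
  classical
  obtain ⟨-, z, m, p, e, θ, T, hT, hCT, hθ, hφ⟩ := h
  obtain ⟨T', hT'⟩ := hT.exists_right_inv
  have hcos : 0 < Real.cos (θ₀ - α) :=
    Real.cos_pos_of_mem_Ioo ⟨by linarith, by linarith⟩
  -- With `β = θ₀ - α`, this choice turns `s (τ² sin β + 2τ cos β)` into `cos² β (2 + s sin β)`,
  -- which is positive.
  set τ : ℝ := s * Real.cos (θ₀ - α) with hτ
  have hss : s * s = 1 := by rcases hs with rfl | rfl <;> norm_num
  let J := {i : Fin m // 0 < s * (θ i - α)} ⊕ Fin p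
  let Y : (J → ℂ) →ₗ[ℂ] (Fin z ⊕ (Fin m ⊕ (Fin 2 × Fin p)) → ℂ) :=
    LinearMap.pi fun i => match i with
      | .inl _ => 0
      | .inr (.inl i) => if h : 0 < s * (θ i - α) then LinearMap.proj (.inl ⟨i, h⟩) else 0
      | .inr (.inr (a, k)) => (![1, -1 + τ * I] a : ℂ) • LinearMap.proj (.inr k)
  have hY1 : ∀ c i (h : 0 < s * (θ i - α)), Y c (.inr (.inl i)) = c (.inl ⟨i, h⟩) := by
    intro c i h
    simp [Y, h]
  have hY2 : ∀ c i, ¬ 0 < s * (θ i - α) → Y c (.inr (.inl i)) = 0 := by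
    intro c i h
    simp [Y, h]
  have hY3 : ∀ c k, Y c (.inr (.inr (0, k))) = c (.inr k) := by
    intro c k
    simp [Y]
  have hY4 : ∀ c k, Y c (.inr (.inr (1, k))) = (-1 + τ * I) * c (.inr k) := by
    intro c k
    simp [Y]
  refine ⟨J, inferInstance, (Matrix.mulVecLin T').comp ((LinearMap.funLeft ℂ ℂ e).comp Y),
    card_pos_phases hφ hs hα hα', fun c hc => ?_⟩
  have hTx : (T *ᵥ ((Matrix.mulVecLin T').comp ((LinearMap.funLeft ℂ ℂ e).comp Y) c)) ∘ e.symm =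
      Y c := by
    ext i
    simp [Matrix.mulVec_mulVec, hT', LinearMap.funLeft_apply]
  rw [hCT, dotProduct_congr_sectorialForm, hTx, im_exp_mul_sectorialForm]
  have ha : ∀ i, 0 ≤ normSq (Y c (.inr (.inl i))) * (s * Real.sin (θ i - α)) := by
    intro i
    by_cases h : 0 < s * (θ i - α)
    · have h1 := hθ i
      exact mul_nonneg (normSq_nonneg _)
        ((mul_sin_pos_iff hs (by linarith) (by linarith)).mpr h).le
    · rw [hY2 c i h, map_zero, zero_mul]
  have hb : ∀ k, s * (exp ((θ₀ - α : ℝ) * I) * (normSq (Y c (.inr (.inr (0, k)))) +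
      normSq (Y c (.inr (.inr (1, k)))) +
      2 * conj (Y c (.inr (.inr (0, k)))) * Y c (.inr (.inr (1, k))))).im =
      normSq (c (.inr k)) * (Real.cos (θ₀ - α) ^ 2 * (2 + s * Real.sin (θ₀ - α))) := by
    intro k
    rw [hY3, hY4, im_exp_mul_block, hτ]
    linear_combination (normSq (c (.inr k)) * (Real.cos (θ₀ - α) ^ 2 *
      (2 + s * Real.sin (θ₀ - α)))) * hss
  have hfac : 0 < Real.cos (θ₀ - α) ^ 2 * (2 + s * Real.sin (θ₀ - α)) := by
    have h1 := Real.sin_le_one (θ₀ - α)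
    have h2 := Real.neg_one_le_sin (θ₀ - α)
    refine mul_pos (pow_pos hcos 2) ?_
    rcases hs with rfl | rfl <;> linarith
  simp only [hb]
  have hb' : ∀ k : Fin p, 0 ≤ normSq (c (.inr k)) *
      (Real.cos (θ₀ - α) ^ 2 * (2 + s * Real.sin (θ₀ - α))) :=
    fun k => mul_nonneg (normSq_nonneg _) hfac.le
  obtain ⟨j, hj⟩ := Function.ne_iff.mp hc
  rcases j with ⟨i, hi⟩ | k
  · refine add_pos_of_pos_of_nonneg ?_ (Finset.sum_nonneg fun k _ => hb' k)
    refine Finset.sum_pos' (fun i _ => ha i) ⟨i, Finset.mem_univ _, ?_⟩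
    have h1 := hθ i
    rw [hY1 c i hi]
    exact mul_pos (normSq_pos.mpr hj) ((mul_sin_pos_iff hs (by linarith) (by linarith)).mpr hi)
  · refine add_pos_of_nonneg_of_pos (Finset.sum_nonneg fun i _ => ha i) ?_
    exact Finset.sum_pos' (fun k _ => hb' k) ⟨k, Finset.mem_univ _,
      mul_pos (normSq_pos.mpr hj) hfac⟩

/-- There is a space of codimension the number of phases on one side of `α` on which the imaginary
part of the rotated quadratic form is semidefinite. -/
theorem IsPhasesAt.exists_semidefinite (h : IsPhasesAt C θ₀ φ) {s α : ℝ} (hs : s = 1 ∨ s = -1)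
    (hα : θ₀ - Real.pi / 2 < α) (hα' : α < θ₀ + Real.pi / 2) :
    ∃ (J : Type) (_ : Fintype J) (l : (ι → ℂ) →ₗ[ℂ] (J → ℂ)),
      Fintype.card J = Fintype.card {i // 0 < s * (φ i - α)} ∧
      ∀ x, l x = 0 → s * (exp (-α * I) * (star x ⬝ᵥ (C *ᵥ x))).im ≤ 0 := by
  classical
  obtain ⟨-, z, m, p, e, θ, T, hT, hCT, hθ, hφ⟩ := h
  set τ : ℝ := s * Real.cos (θ₀ - α) with hτ
  have hss : s * s = 1 := by rcases hs with rfl | rfl <;> norm_num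
  let J := {i : Fin m // 0 < s * (θ i - α)} ⊕ Fin p
  -- One condition per phase on the chosen side: kill its coordinate in `D`, and in each block keep
  -- only the line through `(1, -1 - iτ)`, where the form is a multiple of `cos² β (s sin β - 2) ≤
  -- 0`.
  let Y : (Fin z ⊕ (Fin m ⊕ (Fin 2 × Fin p)) → ℂ) →ₗ[ℂ] (J → ℂ) :=
    LinearMap.pi fun j => match j with
      | .inl i => LinearMap.proj (.inr (.inl i.1))
      | .inr k => LinearMap.proj (.inr (.inr (1, k))) -
          (-1 + (-τ : ℝ) * I) • LinearMap.proj (.inr (.inr (0, k)))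
  refine ⟨J, inferInstance, Y.comp ((LinearMap.funLeft ℂ ℂ e.symm).comp (Matrix.mulVecLin T)),
    card_pos_phases hφ hs hα hα', fun x hx => ?_⟩
  set y : Fin z ⊕ (Fin m ⊕ (Fin 2 × Fin p)) → ℂ := (T *ᵥ x) ∘ e.symm with hy
  have hYy : Y y = 0 := hx
  have hY1 : ∀ i, 0 < s * (θ i - α) → y (.inr (.inl i)) = 0 := by
    intro i h
    exact congrFun hYy (.inl ⟨i, h⟩)
  have hY2 : ∀ k, y (.inr (.inr (1, k))) = (-1 + (-τ : ℝ) * I) * y (.inr (.inr (0, k))) := by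
    intro k
    exact sub_eq_zero.mp (congrFun hYy (.inr k))
  rw [hCT, dotProduct_congr_sectorialForm, ← hy, im_exp_mul_sectorialForm]
  refine add_nonpos (Finset.sum_nonpos fun i _ => ?_) (Finset.sum_nonpos fun k _ => ?_)
  · by_cases h : 0 < s * (θ i - α)
    · rw [hY1 i h, map_zero, zero_mul]
    · have h1 := hθ i
      rw [← mul_sin_pos_iff hs (by linarith) (by linarith)] at h
      exact mul_nonpos_of_nonneg_of_nonpos (normSq_nonneg _) (not_lt.mp h)
  · rw [hY2, im_exp_mul_block, hτ]
    have h1 := Real.sin_le_one (θ₀ - α)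
    have h2 := Real.neg_one_le_sin (θ₀ - α)
    have h3 : s * (normSq (y (.inr (.inr (0, k)))) * ((-(s * Real.cos (θ₀ - α))) ^ 2 *
        Real.sin (θ₀ - α) + 2 * -(s * Real.cos (θ₀ - α)) * Real.cos (θ₀ - α))) =
        normSq (y (.inr (.inr (0, k)))) * (Real.cos (θ₀ - α) ^ 2 *
          (s * Real.sin (θ₀ - α) - 2)) := by
      linear_combination (normSq (y (.inr (.inr (0, k)))) * (Real.cos (θ₀ - α) ^ 2 *
        (s * Real.sin (θ₀ - α) - 2))) * hss
    rw [h3]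
    refine mul_nonpos_of_nonneg_of_nonpos (normSq_nonneg _)
      (mul_nonpos_of_nonneg_of_nonpos (sq_nonneg _) ?_)
    rcases hs with rfl | rfl <;> linarith

/-- Compression does not increase the number of phases on either side of `α`. -/
theorem IsPhasesAt.card_le {κ : Type*} [Fintype κ] [DecidableEq κ] {S : Matrix κ κ ℂ}
    {ψ : Fin S.rank → ℝ} (hC : IsPhasesAt C θ₀ φ) (hS : IsPhasesAt S θ₀ ψ) (X : Matrix ι κ ℂ)
    (hX : ∀ y, star y ⬝ᵥ (S *ᵥ y) = star (X *ᵥ y) ⬝ᵥ (C *ᵥ (X *ᵥ y)))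
    {s α : ℝ} (hs : s = 1 ∨ s = -1)
    (hα : θ₀ - Real.pi / 2 < α) (hα' : α < θ₀ + Real.pi / 2) :
    Fintype.card {i // 0 < s * (ψ i - α)} ≤ Fintype.card {i // 0 < s * (φ i - α)} := by
  obtain ⟨J, _, G, hJ, hG⟩ := hS.exists_definite hs hα hα'
  obtain ⟨J', _, l, hJ', hl⟩ := hC.exists_semidefinite hs hα hα'
  rw [← hJ, ← hJ']
  by_contra! hlt
  -- A dimension count yields a nonzero vector at which the form of `S` is positive, while the form
  -- of `C` at its image is nonpositive; the two values agree by `hX`.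
  have hker : LinearMap.ker (l.comp ((Matrix.mulVecLin X).comp G)) ≠ ⊥ :=
    LinearMap.ker_ne_bot_of_finrank_lt (by simpa using hlt)
  obtain ⟨c, hc, hc0⟩ := Submodule.exists_mem_ne_zero_of_ne_bot hker
  have h1 := hG c hc0
  have h2 := hl (X *ᵥ G c) hc
  rw [hX] at h1
  linarith

/-- Interlacing of the phases of a compression. -/
theorem IsPhasesAt.interlace {κ : Type*} [Fintype κ] [DecidableEq κ] {S : Matrix κ κ ℂ}
    {ψ : Fin S.rank → ℝ} (hC : IsPhasesAt C θ₀ φ) (hS : IsPhasesAt S θ₀ ψ) (X : Matrix ι κ ℂ)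
    (hX : ∀ y, star y ⬝ᵥ (S *ᵥ y) = star (X *ᵥ y) ⬝ᵥ (C *ᵥ (X *ᵥ y)))
    (hr : S.rank ≤ C.rank) (j : Fin S.rank) :
    ψ j ≤ φ ⟨j, j.isLt.trans_le hr⟩ ∧
      φ ⟨C.rank - S.rank + j, by have := j.isLt; omega⟩ ≤ ψ j := by
  have hj := j.isLt
  constructor
  -- Indices start at `0`: at least `j + 1` phases of `S` exceed `α`, but at most `j` phases of `C`
  -- do.
  · by_contra! hlt
    obtain ⟨α, h1, h2⟩ := exists_between hlt
    have hle := hC.card_le hS X hX (s := 1) (α := α) (Or.inl rfl)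
      ((hC.mem_Icc _).1.trans_lt h1) (h2.trans_le (hS.mem_Icc _).2)
    rw [Fintype.card_subtype, Fintype.card_subtype] at hle
    have hlow : (Finset.Iic j).card ≤ (Finset.univ.filter fun i => 0 < 1 * (ψ i - α)).card := by
      refine Finset.card_le_card fun i hi => ?_
      have := hS.1 (Finset.mem_Iic.mp hi)
      simp
      linarith
    have hup : (Finset.univ.filter fun i => 0 < 1 * (φ i - α)).card ≤
        (Finset.Iio (⟨j, hj.trans_le hr⟩ : Fin C.rank)).card := by
      refine Finset.card_le_card fun i hi => ?_
      rw [Finset.mem_Iio]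
      by_contra! hij
      have := hC.1 hij
      simp at hi
      linarith
    rw [Fin.card_Iic] at hlow
    rw [Fin.card_Iio] at hup
    simp only at hup
    omega
  -- Below `α` lie at least `S.rank - j` phases of `S`, but at most `S.rank - j - 1` phases of `C`.
  · by_contra! hlt
    obtain ⟨α, h1, h2⟩ := exists_between hlt
    have hle := hC.card_le hS X hX (s := -1) (α := α) (Or.inr rfl)
      ((hS.mem_Icc _).1.trans_lt h1) (h2.trans_le (hC.mem_Icc _).2)
    rw [Fintype.card_subtype, Fintype.card_subtype] at hle
    have hlow : (Finset.Ici j).card ≤ (Finset.univ.filter fun i => 0 < -1 * (ψ i - α)).card := by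
      refine Finset.card_le_card fun i hi => ?_
      have := hS.1 (Finset.mem_Ici.mp hi)
      simp
      linarith
    have hup : (Finset.univ.filter fun i => 0 < -1 * (φ i - α)).card ≤
        (Finset.Ioi (⟨C.rank - S.rank + j, by omega⟩ : Fin C.rank)).card := by
      refine Finset.card_le_card fun i hi => ?_
      rw [Finset.mem_Ioi]
      by_contra! hij
      have := hC.1 hij
      simp at hi
      linarith
    rw [Fin.card_Ici] at hlow
    rw [Fin.card_Ioi] at hup
    simp only at hup
    omega

end Inertia

/-! ### Convexity of the angular range and the supporting half-plane. -/

theorem isSemiSectorial_iff {ι : Type*} [Fintype ι] {C : Matrix ι ι ℂ} :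
    IsSemiSectorial C ↔ angularRange C ≠ Set.univ := by
  have hpi := Real.pi_pos
  unfold IsSemiSectorial fieldAngle
  split_ifs with h1 h2
  · simp only [h1, ne_eq, not_true_eq_false, iff_false, not_le]
    linarith
  · simp [h1]
  · simp only [ne_eq, h1, not_false_eq_true, iff_true]
    -- The bound `0 ≤ π` covers the empty set of angles, whose `sSup` is `0`.
    refine Real.sSup_le ?_ hpi.le
    rintro a ⟨z, -, w, -, -, -, rfl⟩
    exact InnerProductGeometry.angle_le_pi _ _

/-- The imaginary part is a real linear form in `(w.re, w.im)`, so it vanishes at some unit vector.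
This makes the cross term real in the Toeplitz–Hausdorff argument. -/
theorem exists_im_mul_add_conj_mul_eq_zero (p q : ℂ) :
    ∃ w : ℂ, conj w * w = 1 ∧ (w * p + conj w * q).im = 0 := by
  set v : ℂ := ⟨-(p.re - q.re), p.im + q.im⟩ with hv
  by_cases h : v = 0
  · have h1 : p.re - q.re = 0 := by
      have h0 : -(p.re - q.re) = 0 := congrArg re h
      linarith
    have h2 : p.im + q.im = 0 := congrArg im h
    exact ⟨1, by simp, by simpa using h2⟩
  · have hn : (‖v‖ : ℂ) ≠ 0 := ofReal_ne_zero.mpr (norm_ne_zero_iff.mpr h)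
    refine ⟨((‖v‖⁻¹ : ℝ) : ℂ) * v, ?_, ?_⟩
    · rw [map_mul, conj_ofReal, mul_mul_mul_comm, conj_mul', ofReal_inv]
      field_simp
    · rw [map_mul, conj_ofReal, mul_assoc, mul_assoc, ← mul_add, im_ofReal_mul]
      simp [hv]
      right
      ring

theorem smul_mem_angularRange {ι : Type*} [Fintype ι] {C : Matrix ι ι ℂ} {z : ℂ}
    (hz : z ∈ angularRange C) {r : ℝ} (hr : 0 < r) : (r : ℂ) * z ∈ angularRange C := by
  obtain ⟨x, hx, rfl⟩ := hz
  have hs : (Real.sqrt r : ℂ) ≠ 0 := ofReal_ne_zero.mpr (Real.sqrt_pos.mpr hr).ne'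
  refine ⟨(Real.sqrt r : ℂ) • x, smul_ne_zero hs hx, ?_⟩
  rw [Matrix.mulVec_smul, dotProduct_smul, star_smul, smul_dotProduct, smul_eq_mul, smul_eq_mul,
    ← mul_assoc]
  congr 1
  rw [← starRingEnd_apply, conj_ofReal, ← ofReal_mul, Real.mul_self_sqrt hr.le]

/-- The **Toeplitz–Hausdorff theorem** for the angular numerical range. -/
theorem convex_angularRange {ι : Type*} [Fintype ι] (C : Matrix ι ι ℂ) :
    Convex ℝ (angularRange C) := by
  rintro _ ⟨x, hx, rfl⟩ _ ⟨y, hy, rfl⟩ t t' ht ht' htt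
  simp only [← sesqForm_apply, real_smul]
  by_cases hdep : ∃ c : ℂ, y = c • x
  · obtain ⟨c, rfl⟩ := hdep
    have hc : c ≠ 0 := fun h => hy (by rw [h, zero_smul])
    have h1 : (t : ℂ) * sesqForm C x x + t' * sesqForm C (c • x) (c • x) =
        ((t + t' * normSq c : ℝ) : ℂ) * sesqForm C x x := by
      simp only [map_smulₛₗ, LinearMap.smul_apply, smul_eq_mul, RingHom.id_apply]
      push_cast
      rw [normSq_eq_conj_mul_self]
      ring
    rw [h1]
    refine smul_mem_angularRange ⟨x, hx, rfl⟩ ?_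
    have h2 := normSq_pos.mpr hc
    rcases ht.eq_or_lt with rfl | hlt
    · have : t' = 1 := by linarith
      rw [this]
      linarith
    · have := mul_nonneg ht' h2.le
      linarith
  by_cases hab : sesqForm C x x = sesqForm C y y
  · rw [← hab, ← add_mul, ← ofReal_add, htt, ofReal_one, one_mul]
    exact ⟨x, hx, rfl⟩
  set d := sesqForm C x x - sesqForm C y y with hd
  have hd0 : d ≠ 0 := sub_ne_zero.mpr hab
  obtain ⟨w, hw, him⟩ := exists_im_mul_add_conj_mul_eq_zero (sesqForm C x y / d) (sesqForm C y x / d)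
  obtain ⟨ρ, hρ⟩ : ∃ ρ : ℝ, w * (sesqForm C x y / d) + conj w * (sesqForm C y x / d) = ρ :=
    ⟨_, Complex.ext rfl him⟩
  have hρ' : w * sesqForm C x y + conj w * sesqForm C y x = ρ * d := by
    rw [← hρ]
    field_simp
  have hw0 : w ≠ 0 := by
    rintro rfl
    simp at hw
  -- At `cos s · x + sin s · w y` the form takes the value `B(y,y) + d (cos² s + cos s sin s · ρ)`,
  -- which stays on the line through the two given values. The real factor runs from `1` to `0`, so
  -- it attains `t`.
  obtain ⟨s, -, hs⟩ : t ∈ (fun s : ℝ => Real.cos s ^ 2 + Real.cos s * Real.sin s * ρ) ''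
      Set.Icc 0 (Real.pi / 2) := by
    refine intermediate_value_Icc' (by positivity) (by fun_prop) ?_
    simp only [Real.cos_pi_div_two, Real.cos_zero, Real.sin_zero, Real.sin_pi_div_two]
    constructor <;> linarith
  simp only at hs
  refine ⟨(Real.cos s : ℂ) • x + (Real.sin s * w) • y, ?_, ?_⟩
  · intro h0
    by_cases hsin : Real.sin s = 0
    · have hcos : Real.cos s ≠ 0 := by
        intro h
        have := Real.sin_sq_add_cos_sq s
        rw [hsin, h] at this
        norm_num at this
      rw [hsin, ofReal_zero, zero_mul, zero_smul, add_zero] at h0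
      exact hx ((smul_eq_zero.mp h0).resolve_left (ofReal_ne_zero.mpr hcos))
    · have hne : (Real.sin s * w : ℂ) ≠ 0 := mul_ne_zero (ofReal_ne_zero.mpr hsin) hw0
      refine hdep ⟨-(Real.sin s * w : ℂ)⁻¹ * Real.cos s, ?_⟩
      have h1 : (Real.sin s * w : ℂ) • y = -((Real.cos s : ℂ) • x) :=
        eq_neg_of_add_eq_zero_right h0
      rw [mul_smul, neg_smul, ← smul_neg, ← h1, smul_smul, inv_mul_cancel₀ hne, one_smul]
  · rw [← sesqForm_apply]
    simp only [map_add, LinearMap.add_apply, map_smulₛₗ, LinearMap.smul_apply, smul_eq_mul,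
      RingHom.id_apply, map_mul, conj_ofReal]
    have hsc : (Real.sin s : ℂ) ^ 2 + (Real.cos s : ℂ) ^ 2 = 1 := by
      exact_mod_cast Real.sin_sq_add_cos_sq s
    have hs' : (Real.cos s : ℂ) ^ 2 + Real.cos s * Real.sin s * ρ = t := by exact_mod_cast hs
    have htt' : (t : ℂ) + t' = 1 := by exact_mod_cast htt
    linear_combination -d * hs' - sesqForm C y y * hsc + sesqForm C y y * htt' -
      (Real.cos s * Real.sin s : ℂ) * hρ' - (Real.sin s : ℂ) ^ 2 * sesqForm C y y * hw +
      ((Real.cos s : ℂ) ^ 2 - t) * hd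

/-- A dense convex set in a finite-dimensional space is the whole space. -/
theorem eq_univ_of_convex_of_dense {E : Type*} [NormedAddCommGroup E] [NormedSpace ℝ E]
    [FiniteDimensional ℝ E] {K : Set E} (hK : Convex ℝ K) (hd : closure K = Set.univ) :
    K = Set.univ := by
  -- The affine span is closed, so density makes it everything and `K` has interior; a convex set
  -- with interior has the same interior as its closure.
  have hspan : affineSpan ℝ K = ⊤ := by
    have hcl : IsClosed (affineSpan ℝ K : Set E) := AffineSubspace.closed_of_finiteDimensional _
    have h1 := closure_minimal (subset_affineSpan ℝ K) hcl
    rw [hd] at h1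
    exact SetLike.coe_injective (Set.univ_subset_iff.mp h1)
  have hint := hK.interior_nonempty_iff_affineSpan_eq_top.mpr hspan
  have h2 := hK.interior_closure_eq_interior_of_nonempty_interior hint
  rw [hd, interior_univ] at h2
  exact Set.univ_subset_iff.mp (h2 ▸ interior_subset)

/-- The numerical range of a semi-sectorial matrix lies in a half-plane. -/
theorem IsSemiSectorial.exists_halfPlane {ι : Type*} [Fintype ι] {C : Matrix ι ι ℂ}
    (hC : IsSemiSectorial C) :
    ∃ θ₀ : ℝ, ∀ x : ι → ℂ, 0 ≤ (exp (-θ₀ * I) * (star x ⬝ᵥ (C *ᵥ x))).re := by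
  rw [isSemiSectorial_iff] at hC
  have hcl : closure (angularRange C) ≠ Set.univ :=
    fun h => hC (eq_univ_of_convex_of_dense (convex_angularRange C) h)
  obtain ⟨z₀, hz₀⟩ := (Set.ne_univ_iff_exists_notMem _).mp hcl
  obtain ⟨f, u, hu, huz⟩ := geometric_hahn_banach_closed_point
    (convex_angularRange C).closure isClosed_closure hz₀
  -- A functional bounded above on a cone is nonpositive there.
  have hneg : ∀ z ∈ angularRange C, f z ≤ 0 := by
    intro z hz
    by_contra! hpos
    have h1 := hu _ (subset_closure (smul_mem_angularRange hz
      (r := (|u| + 1) / f z) (div_pos (by positivity) hpos)))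
    rw [← real_smul, map_smul, smul_eq_mul, div_mul_cancel₀ _ hpos.ne'] at h1
    linarith [le_abs_self u]
  set d : ℂ := ⟨-f 1, -f I⟩ with hd
  have hfd : ∀ z, (conj d * z).re = -f z := by
    intro z
    have h1 : f z = z.re * f 1 + z.im * f I := by
      conv_lhs => rw [show z = z.re • (1 : ℂ) + z.im • I by simp [real_smul, re_add_im]]
      rw [map_add, map_smul, map_smul, smul_eq_mul, smul_eq_mul]
    rw [h1]
    simp [hd]
    ring
  -- A zero functional separates nothing from a nonempty set, so here no nonzero `x` exists and any
  -- angle will do.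
  by_cases hd0 : d = 0
  · refine ⟨0, fun x => ?_⟩
    by_cases hx : x = 0
    · simp [hx]
    · exfalso
      have hf : ∀ z, f z = 0 := by
        intro z
        have := hfd z
        rw [hd0] at this
        simpa using this
      have h1 := hu _ (subset_closure ⟨x, hx, rfl⟩)
      rw [hf] at h1 huz
      exact lt_asymm h1 huz
  · refine ⟨d.arg, fun x => ?_⟩
    by_cases hx : x = 0
    · simp [hx]
    · have h1 := hneg _ ⟨x, hx, rfl⟩
      have h2 : conj d = (‖d‖ : ℂ) * exp (-d.arg * I) := by
        conv_lhs => rw [← norm_mul_exp_arg_mul_I d]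
        rw [map_mul, conj_ofReal, ← exp_conj, map_mul, conj_ofReal, conj_I]
        ring_nf
      have h3 := hfd (star x ⬝ᵥ (C *ᵥ x))
      rw [h2, mul_assoc, re_ofReal_mul] at h3
      have h4 : 0 < ‖d‖ := norm_pos_iff.mpr hd0
      exact nonneg_of_mul_nonneg_right (by linarith) h4

/-! ### Recentring phases, and the Schur complement as a compression. -/

/-- After rotation the angles of `D` have nonnegative cosine, and each block contributes `|u + v|²`.
The bound passes to `S` and gives it phases with the same centre. -/
theorem IsPhasesAt.nonneg_re {ι : Type*} [Fintype ι] [DecidableEq ι] {C : Matrix ι ι ℂ} {θ₀ : ℝ}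
    {φ : Fin C.rank → ℝ} (h : IsPhasesAt C θ₀ φ) (x : ι → ℂ) :
    0 ≤ (exp (-θ₀ * I) * (star x ⬝ᵥ (C *ᵥ x))).re := by
  obtain ⟨-, z, m, p, e, θ, T, -, hCT, hθ, -⟩ := h
  have hexp : ∀ t : ℝ, exp (-θ₀ * I) * exp (t * I) = exp ((t - θ₀ : ℝ) * I) := by
    intro t
    rw [← exp_add, ofReal_sub]
    ring_nf
  rw [hCT, dotProduct_congr_sectorialForm, dotProduct_sectorialForm, mul_add, add_re,
    Finset.mul_sum, Finset.mul_sum, re_sum, re_sum]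
  refine add_nonneg (Finset.sum_nonneg fun i _ => ?_) (Finset.sum_nonneg fun k _ => ?_)
  · rw [← mul_assoc, hexp, re_mul_ofReal, exp_ofReal_mul_I_re]
    have := hθ i
    exact mul_nonneg (Real.cos_nonneg_of_mem_Icc ⟨by linarith, by linarith⟩) (normSq_nonneg _)
  · rw [← mul_assoc, hexp, sub_self]
    generalize ((T *ᵥ x) ∘ e.symm) (.inr (.inr (0, k))) = u
    generalize ((T *ᵥ x) ∘ e.symm) (.inr (.inr (1, k))) = v
    simp only [ofReal_zero, zero_mul, exp_zero, one_mul]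
    have h1 : (normSq u + normSq v + 2 * conj u * v : ℂ).re =
        (u.re + v.re) ^ 2 + (u.im + v.im) ^ 2 := by
      simp [normSq_apply]
      ring
    rw [h1]
    positivity

/-- A selection of phases in a closed half-circle is a selection with the centre of that
half-circle. -/
theorem IsPhases.isPhasesAt {ι : Type*} [Fintype ι] [DecidableEq ι] {C : Matrix ι ι ℂ}
    {φ : Fin C.rank → ℝ} (h : IsPhases C φ) {θ₀ : ℝ}
    (hφ : ∀ j, θ₀ - Real.pi / 2 ≤ φ j ∧ φ j ≤ θ₀ + Real.pi / 2) : IsPhasesAt C θ₀ φ := by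
  obtain ⟨hanti, z, m, p, e, θ₁, θ, T, hT, hCT, -, hms⟩ := h
  have hmem : ∀ t ∈ Multiset.map θ Finset.univ.val + Multiset.replicate p (θ₁ + Real.pi / 2) +
      Multiset.replicate p (θ₁ - Real.pi / 2), θ₀ - Real.pi / 2 ≤ t ∧ t ≤ θ₀ + Real.pi / 2 := by
    intro t ht
    rw [← hms] at ht
    obtain ⟨j, -, rfl⟩ := Multiset.mem_map.mp ht
    exact hφ j
  have hθ : ∀ i, θ₀ - Real.pi / 2 ≤ θ i ∧ θ i ≤ θ₀ + Real.pi / 2 := fun i =>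
    hmem _ (Multiset.mem_add.mpr (Or.inl (Multiset.mem_add.mpr (Or.inl
      (Multiset.mem_map_of_mem _ (Finset.mem_univ i))))))
  -- Without blocks the centre does not enter the canonical matrix. With a block, both `θ₁ ± π/2`
  -- are phases, and an interval of length `π` containing both has midpoint `θ₁`.
  rcases Nat.eq_zero_or_pos p with rfl | hp
  · refine ⟨hanti, z, m, 0, e, θ, T, hT, ?_, hθ, by simpa using hms⟩
    have hform : (sectorialForm θ₁ θ : Matrix (Fin z ⊕ (Fin m ⊕ (Fin 2 × Fin 0))) _ ℂ) =
        sectorialForm θ₀ θ := by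
      unfold sectorialForm
      congr 2
      ext i
      exact i.2.elim0
    rw [← hform]
    exact hCT
  · have h1 := hmem (θ₁ + Real.pi / 2) (by simp [Multiset.mem_replicate, hp.ne'])
    have h2 := hmem (θ₁ - Real.pi / 2) (by simp [Multiset.mem_replicate, hp.ne'])
    obtain rfl : θ₁ = θ₀ := by linarith
    exact ⟨hanti, z, m, p, e, θ, T, hT, hCT, hθ, hms⟩

/-- The generalized Schur complement is a compression of the matrix. -/
theorem schurComplement_eq_conjTranspose_mul_mul {m n : Type*} [Fintype m] [Fintype n]
    [DecidableEq n] (C₁₁ : Matrix m m ℂ) (C₁₂ : Matrix m n ℂ) (C₂₁ : Matrix n m ℂ)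
    (C₂₂ : Matrix n n ℂ)
    (h₁₂ : LinearMap.range C₁₂.mulVecLin ≤ LinearMap.range C₁₁.mulVecLin) :
    schurComplement C₁₁ C₁₂ C₂₁ C₂₂ = (Matrix.fromRows (-(pinv C₁₁ * C₁₂)) (1 : Matrix n n ℂ))ᴴ *
      Matrix.fromBlocks C₁₁ C₁₂ C₂₁ C₂₂ * Matrix.fromRows (-(pinv C₁₁ * C₁₂)) (1 : Matrix n n ℂ) := by
  -- `C₁₁ C₁₁†` fixes the range of `C₁₁`, hence the columns of `C₁₂`; this kills the upper block of
  -- `C X`.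
  have h : C₁₁ * pinv C₁₁ * C₁₂ = C₁₂ := by
    classical
    refine Matrix.toLin'.injective (LinearMap.ext fun v => ?_)
    obtain ⟨w, hw⟩ := h₁₂ ⟨v, rfl⟩
    simp only [Matrix.mulVecLin_apply] at hw
    rw [Matrix.toLin'_apply, Matrix.toLin'_apply, ← Matrix.mulVec_mulVec, ← hw,
      Matrix.mulVec_mulVec, (isMoorePenrose_pinv C₁₁).mul_mul_left]
  have h' : C₁₁ * (pinv C₁₁ * C₁₂) = C₁₂ := by rw [← Matrix.mul_assoc, h]
  rw [Matrix.mul_assoc, Matrix.fromBlocks_mul_fromRows,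
    Matrix.conjTranspose_fromRows_eq_fromCols_conjTranspose,
    Matrix.fromCols_mul_fromRows, schurComplement]
  simp only [Matrix.mul_neg, h', Matrix.mul_one, neg_add_cancel, Matrix.mul_zero, zero_add,
    Matrix.conjTranspose_one, Matrix.one_mul, Matrix.mul_assoc]
  abel

end MatrixPhase

theorem lemma4p4 {m n : Type*} [Fintype m] [DecidableEq m] [Fintype n] [DecidableEq n]
    (C₁₁ : Matrix m m ℂ) (C₁₂ : Matrix m n ℂ) (C₂₁ : Matrix n m ℂ) (C₂₂ : Matrix n n ℂ)
    (C : Matrix (m ⊕ n) (m ⊕ n) ℂ) (hC : C = Matrix.fromBlocks C₁₁ C₁₂ C₂₁ C₂₂)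
    (S : Matrix n n ℂ) (hS : S = MatrixPhase.schurComplement C₁₁ C₁₂ C₂₁ C₂₂)
    (hsemi : MatrixPhase.IsSemiSectorial C)
    (h₁₂ : LinearMap.range C₁₂.mulVecLin ≤ LinearMap.range C₁₁.mulVecLin)
    (h₂₁ : LinearMap.range C₂₁ᴴ.mulVecLin ≤ LinearMap.range C₁₁ᴴ.mulVecLin) :
    MatrixPhase.IsSemiSectorial S ∧
    (∃ φ : Fin C.rank → ℝ, MatrixPhase.IsPhases C φ) ∧
    ∃ hr : S.rank ≤ C.rank,
      ∀ φ : Fin C.rank → ℝ, MatrixPhase.IsPhases C φ →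
        -- the phases of `S` can be selected between the smallest and the largest phase of `C`
        (∃ ψ : Fin S.rank → ℝ, MatrixPhase.IsPhases S ψ ∧
          ∀ j, ∃ i i', φ i' ≤ ψ j ∧ ψ j ≤ φ i) ∧
        -- and then they interlace with those of `C`
        ∀ ψ : Fin S.rank → ℝ, MatrixPhase.IsPhases S ψ →
          (∀ j, ∃ i i', φ i' ≤ ψ j ∧ ψ j ≤ φ i) →
          ∀ j : Fin S.rank,
            φ ⟨j, j.isLt.trans_le hr⟩ ≥ ψ j ∧
            ψ j ≥ φ ⟨C.rank - S.rank + j, by have := j.isLt; omega⟩ := by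
  set X : Matrix (m ⊕ n) n ℂ := Matrix.fromRows (-(MatrixPhase.pinv C₁₁ * C₁₂)) 1 with hXdef
  have hSX : S = Xᴴ * C * X := by
    rw [hS, hC]
    exact MatrixPhase.schurComplement_eq_conjTranspose_mul_mul C₁₁ C₁₂ C₂₁ C₂₂ h₁₂
  have hX : ∀ y, star y ⬝ᵥ (S *ᵥ y) = star (X *ᵥ y) ⬝ᵥ (C *ᵥ (X *ᵥ y)) := by
    intro y
    rw [hSX, ← Matrix.mulVec_mulVec, ← Matrix.mulVec_mulVec, Matrix.dotProduct_mulVec,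
      ← Matrix.star_mulVec]
  have hXinj : ∀ y, X *ᵥ y = 0 → y = 0 := by
    intro y hy
    rw [hXdef, Matrix.fromRows_mulVec, Matrix.one_mulVec] at hy
    ext i
    exact congrFun hy (Sum.inr i)
  have hr : S.rank ≤ C.rank := by
    rw [hSX]
    exact (Matrix.rank_mul_le_left _ _).trans (Matrix.rank_mul_le_right _ _)
  refine ⟨?_, ?_, hr, ?_⟩
  · rw [MatrixPhase.isSemiSectorial_iff] at hsemi ⊢
    refine fun h => hsemi (Set.eq_univ_of_univ_subset (h ▸ ?_))
    rintro _ ⟨y, hy, rfl⟩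
    exact ⟨X *ᵥ y, fun h0 => hy (hXinj y h0), hX y⟩
  · obtain ⟨θ₀, hθ₀⟩ := hsemi.exists_halfPlane
    obtain ⟨φ, hφ⟩ := MatrixPhase.exists_isPhasesAt C θ₀ hθ₀
    exact ⟨φ, MatrixPhase.isPhases_iff.mpr ⟨θ₀, hφ⟩⟩
  · intro φ hφ
    obtain ⟨θ₀, hφ⟩ := MatrixPhase.isPhases_iff.mp hφ
    refine ⟨?_, fun ψ hψ hψφ j => ?_⟩
    -- Choosing the centre of `φ` for `S` as well, interlacing itself places the phases of `S`
    -- between those of `C`.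
    · obtain ⟨ψ, hψ⟩ := MatrixPhase.exists_isPhasesAt S θ₀ fun y => by
        rw [hX]
        exact hφ.nonneg_re _
      refine ⟨ψ, MatrixPhase.isPhases_iff.mpr ⟨θ₀, hψ⟩, fun j => ?_⟩
      have := hφ.interlace hψ X hX hr j
      exact ⟨_, _, this.2, this.1⟩
    · have hψ' : MatrixPhase.IsPhasesAt S θ₀ ψ := hψ.isPhasesAt fun j => by
        obtain ⟨i, i', h1, h2⟩ := hψφ j
        exact ⟨(hφ.mem_Icc i').1.trans h1, h2.trans (hφ.mem_Icc i).2⟩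
      exact hφ.interlace hψ' X hX hr j
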